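/- Let $M$ be a (second countable Hausdorff) manifold and let $\mathcal{F}$ be a codimension one, transversely orientable $C^0$ foliation of $M$ which is minimal, i.e. every leaf is dense in $M$. Suppose that there is an integer $k \ge 0$ such that, for every leaf $L$ of $\mathcal{F}$ (with its leaf topology), the fundamental group $\pi_1(L)$ has polynomial growth of degree $k$; that is, $\pi_1(L)$ has a finite generating set for which the number $b(m)$ of elements of word length at most $m$ satisfies $\alpha m^k \le b(m) \le \beta m^k$ for all $m \ge 1$, with constants $\alpha, \beta > 0$ (which may depend on $L$). Suppose that there is a leaf $L_0$ without holonomy, i.e. with trivial holonomy group, such that the homomorphism $i_* : \pi_1(L_0) \to \pi_1(M)$ induced by the inclusion $i : L_0 \to M$ is injective. Then $\mathcal{F}$ is without holonomy, i.e. every leaf of $\mathcal{F}$ has trivial holonomy group. -/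

import Mathlib

open Topology
open scoped Pointwise

/-- A group has polynomial growth of degree `k` if it is generated by a finite set `S` for which
the number of elements of word length at most `m` lies between two positive multiples of `m ^ k`
for all `m ≥ 1`. The elements of word length at most `m` are the products of `m` elements of
`{1} ∪ S ∪ S⁻¹`. -/
def HasPolynomialGrowthOfDegree (G : Type*) [Group G] (k : ℕ) : Prop :=
  ∃ S : Set G, S.Finite ∧ Subgroup.closure S = ⊤ ∧
    ∃ α β : ℝ, 0 < α ∧ 0 < β ∧ ∀ m : ℕ, 1 ≤ m →
      α * (m : ℝ) ^ k ≤ ((({1} ∪ S ∪ S⁻¹) ^ m : Set G).ncard : ℝ) ∧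
      ((({1} ∪ S ∪ S⁻¹) ^ m : Set G).ncard : ℝ) ≤ β * (m : ℝ) ^ k

/-- Topological charts of `M` with values in (open subsets of) `ℝⁿ × ℝ`. The first coordinate is
thought of as the leaf coordinate, the second one as the transverse coordinate. -/
abbrev ProductChart (n : ℕ) (M : Type*) [TopologicalSpace M] :=
  OpenPartialHomeomorph M (EuclideanSpace ℝ (Fin n) × ℝ)

/-- Near the point `x`, the transverse coordinate of `ψ` is the image under the local
homeomorphism `h` of `ℝ` of the transverse coordinate of `φ`. -/
def IsTransverseTransition {n : ℕ} {M : Type*} [TopologicalSpace M] (φ ψ : ProductChart n M)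
    (x : M) (h : OpenPartialHomeomorph ℝ ℝ) : Prop :=
  x ∈ φ.source ∧ x ∈ ψ.source ∧
    ∀ᶠ y in 𝓝 x, (φ y).2 ∈ h.source ∧ (ψ y).2 = h (φ y).2

/-- A codimension one `C^0` foliation of `M` with leaves of dimension `n`, given by a foliated
atlas: charts to `ℝⁿ × ℝ` that cover `M` and whose coordinate changes are locally of the form
`(u, s) ↦ (f (u, s), h s)`. In particular `M` is locally Euclidean of dimension `n + 1`. -/
structure CodimOneFoliation (n : ℕ) (M : Type*) [TopologicalSpace M] where
  /-- the foliated charts -/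
  atlas : Set (ProductChart n M)
  covers : ∀ x : M, ∃ φ ∈ atlas, x ∈ φ.source
  compatible : ∀ φ ∈ atlas, ∀ ψ ∈ atlas, ∀ x ∈ φ.source ∩ ψ.source,
    ∃ h : OpenPartialHomeomorph ℝ ℝ, IsTransverseTransition φ ψ x h

namespace CodimOneFoliation

variable {n : ℕ} {M : Type*} [TopologicalSpace M] (F : CodimOneFoliation n M)

/-- A chart of `M` is foliated for `F` if it is compatible with every chart of the atlas. -/
def IsFoliatedChart (φ : ProductChart n M) : Prop :=
  ∀ ψ ∈ F.atlas, ∀ x ∈ φ.source ∩ ψ.source,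
    ∃ h : OpenPartialHomeomorph ℝ ℝ, IsTransverseTransition φ ψ x h

/-- The transverse coordinate changes of the atlas can be chosen increasing. -/
def IsOrientedAtlas : Prop :=
  ∀ φ ∈ F.atlas, ∀ ψ ∈ F.atlas, ∀ x ∈ φ.source ∩ ψ.source,
    ∃ h : OpenPartialHomeomorph ℝ ℝ, IsTransverseTransition φ ψ x h ∧ StrictMonoOn h h.source

/-- `F` is transversely orientable: the same foliation is given by some atlas of foliated charts
all of whose transverse coordinate changes are increasing. -/
def IsTransverselyOrientable : Prop :=
  ∃ G : CodimOneFoliation n M, (∀ φ ∈ G.atlas, F.IsFoliatedChart φ) ∧ G.IsOrientedAtlas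

/-- The points of `M`, to be equipped with the leaf topology. -/
def FineSpace (_F : CodimOneFoliation n M) : Type _ := M

/-- The identity map from `M` to `M` with the leaf topology. -/
def toFine : M ≃ F.FineSpace := Equiv.refl M

/-- The leaf topology: it is generated by the (relatively) open subsets of the plaques, that is,
of the level sets of the transverse coordinates of the charts. -/
instance : TopologicalSpace F.FineSpace :=
  TopologicalSpace.generateFrom
    {P | ∃ V : Set M, IsOpen V ∧ ∃ φ ∈ F.atlas, ∃ s : ℝ,
      P = F.toFine '' {y | y ∈ V ∧ y ∈ φ.source ∧ (φ y).2 = s}}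

theorem continuous_toFine_symm : Continuous F.toFine.symm := by
  refine continuous_def.2 fun V hV => ?_
  rw [isOpen_iff_forall_mem_open]
  intro y hy
  obtain ⟨φ, hφ, hyφ⟩ := F.covers (F.toFine.symm y)
  refine ⟨F.toFine '' {z | z ∈ V ∧ z ∈ φ.source ∧ (φ z).2 = (φ (F.toFine.symm y)).2}, ?_, ?_, ?_⟩
  · rintro _ ⟨z, hz, rfl⟩
    simpa using hz.1
  · exact TopologicalSpace.isOpen_generateFrom_of_mem ⟨V, hV, φ, hφ, _, rfl⟩
  · exact ⟨F.toFine.symm y, ⟨hy, hyφ, rfl⟩, by simp⟩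

/-- The leaf through `x`, as a subset of `M`: the path component of `x` in the leaf topology. -/
def leaf (x : M) : Set M := F.toFine ⁻¹' pathComponent (F.toFine x)

/-- The leaf through `x`, as a topological space with the leaf topology. -/
abbrev LeafSpace (x : M) : Type _ := ↥(pathComponent (F.toFine x))

/-- The point `x` of the leaf through `x`. -/
def leafBase (x : M) : F.LeafSpace x := ⟨F.toFine x, mem_pathComponent_self _⟩

/-- The inclusion of the leaf through `x` into `M`. -/
def leafInclusion (x : M) : C(F.LeafSpace x, M) where
  toFun y := F.toFine.symm y.1
  continuous_toFun := F.continuous_toFine_symm.comp continuous_subtype_val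

/-- `F` is minimal: every leaf is dense. -/
def IsMinimal : Prop := ∀ x : M, Dense (F.leaf x)

/-- The composite `g (m - 1) ∘ ⋯ ∘ g 1 ∘ g 0` of local homeomorphisms of `ℝ`. -/
def composeTransitions (g : ℕ → OpenPartialHomeomorph ℝ ℝ) : ℕ → OpenPartialHomeomorph ℝ ℝ
  | 0 => OpenPartialHomeomorph.refl ℝ
  | m + 1 => (composeTransitions g m).trans (g m)

/-- `h` is a holonomy map along the path `γ` in a leaf, in the transverse coordinates of the charts
`φ` and `ψ` at its end points: `γ` is cut into finitely many pieces
`γ [t i, t (i + 1)] ⊆ (χ i).source`, starting with `χ 0 = φ` and followed by `χ m = ψ`, and `h` is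
the composite of the transverse coordinate changes from `χ i` to `χ (i + 1)` at `γ (t (i + 1))`.
(A path that is continuous for the leaf topology stays in one leaf, and the transverse coordinate of
`χ i` is constant on its `i`-th piece.) -/
def IsHolonomyMap {x y : M} (γ : Path (F.toFine x) (F.toFine y)) (φ ψ : ProductChart n M)
    (h : OpenPartialHomeomorph ℝ ℝ) : Prop :=
  ∃ (m : ℕ) (t : ℕ → unitInterval) (χ : ℕ → ProductChart n M)
    (g : ℕ → OpenPartialHomeomorph ℝ ℝ),
    Monotone t ∧ t 0 = 0 ∧ t m = 1 ∧ χ 0 = φ ∧ χ m = ψ ∧ (∀ i ≤ m, χ i ∈ F.atlas) ∧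
    (∀ i < m, ∀ s ∈ Set.Icc (t i) (t (i + 1)), F.toFine.symm (γ s) ∈ (χ i).source) ∧
    (∀ i < m, IsTransverseTransition (χ i) (χ (i + 1)) (F.toFine.symm (γ (t (i + 1)))) (g i)) ∧
    h = composeTransitions g m

/-- The loop `γ` in a leaf has trivial holonomy: in every chart around its base point, every
holonomy map along `γ` is the identity near the base point. -/
def HasTrivialHolonomy {x : M} (γ : Path (F.toFine x) (F.toFine x)) : Prop :=
  ∀ φ ∈ F.atlas, ∀ h : OpenPartialHomeomorph ℝ ℝ, F.IsHolonomyMap γ φ φ h →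
    ∀ᶠ s in 𝓝 (φ x).2, h s = s

/-- The leaf through `x` is without holonomy: every loop in it, at every base point, has trivial
holonomy. -/
def LeafWithoutHolonomy (x : M) : Prop :=
  ∀ y ∈ F.leaf x, ∀ γ : Path (F.toFine y) (F.toFine y), F.HasTrivialHolonomy γ

/-- `F` is without holonomy: every leaf is without holonomy. -/
def IsWithoutHolonomy : Prop := ∀ x : M, F.LeafWithoutHolonomy x

end CodimOneFoliation

/-!
The holonomy of a loop in a leaf is the monodromy of a covering. A function on `M` is transverse
at `x` if near `x` it is a local homeomorphism of `ℝ` applied to a transverse coordinate; the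
germs of transverse functions form a space `TransverseGerm` over `M` with the leaf topology, and
its projection is a covering map (`isCoveringMap_pt`). The relation `Continues γ f g` says that
monodromy along `γ` takes the germ of `f` to that of `g`. Holonomy maps compute it
(`IsHolonomyMap.continues`), so that a loop has trivial holonomy if and only if it fixes some
transverse germ, equivalently all of them.

Let `γ` be a loop at a point `y`, let `x₀` be the base point of the leaf without holonomy, and let
`s₁, …, sᵣ` generate its fundamental group `G₀`. As `sᵢ` has trivial holonomy, it can be pushed to
loops, again with trivial holonomy, at all points `z` near `x₀`, and in `M` these are homotopic to
`sᵢ` up to a short change of base point (`Continues.eventually_exists_parallel`). By minimality,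
`z` can be taken in the leaf `L` of `y`. The subgroup `N` of `π₁(L, z)` of the classes with
trivial holonomy then has an image in `π₁(M)` that contains a copy of `G₀`, because `G₀` injects
into `π₁(M)`. Hence `N` contains a finitely generated subgroup that grows at least like `m ^ k`,
while `π₁(L)` itself grows at most like `m ^ k`. This forces `N` to contain a power of each
element (`HasPolynomialGrowthOfDegree.exists_pow_mem`), so some power of `γ` has trivial holonomy.
Since the foliation is transversely orientable, the holonomy of `γ` is an increasing germ; an
increasing germ of finite order is the identity (`Continues.of_pow`).
-/

/-! ### Subgroups of groups of polynomial growth -/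

theorem Set.Finite.exists_subset_pow_of_closure_eq_top {G : Type*} [Group G] {S A : Set G}
    (hS : Subgroup.closure S = ⊤) (hA : A.Finite) :
    ∃ c : ℕ, 1 ≤ c ∧ A ⊆ ({1} ∪ S ∪ S⁻¹) ^ c := by
  set B : Set G := {1} ∪ S ∪ S⁻¹
  have h1 : (1 : G) ∈ B := Or.inl (Or.inl rfl)
  have hmono : ∀ {a b : ℕ}, a ≤ b → B ^ a ⊆ B ^ b := fun h => Set.pow_subset_pow_right h1 h
  have hinv : ∀ x ∈ B, x⁻¹ ∈ B := by
    rintro x ((rfl | hx) | hx)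
    · exact Or.inl (Or.inl (by simp))
    · exact Or.inr (by simpa using hx)
    · exact Or.inl (Or.inr hx)
  have key : ∀ g : G, ∃ c : ℕ, g ∈ B ^ c := by
    intro g
    have hg : g ∈ Subgroup.closure S := by rw [hS]; trivial
    induction hg using Subgroup.closure_induction with
    | mem x hx => exact ⟨1, by rw [pow_one]; exact Or.inl (Or.inr hx)⟩
    | one => exact ⟨0, by simp⟩
    | mul x y _ _ hx hy =>
      obtain ⟨a, ha⟩ := hx
      obtain ⟨b, hb⟩ := hy
      exact ⟨a + b, by rw [pow_add]; exact Set.mul_mem_mul ha hb⟩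
    | inv x _ hx =>
      obtain ⟨a, ha⟩ := hx
      refine ⟨a, ?_⟩
      have : B⁻¹ = B := by
        ext x
        exact ⟨fun h => by simpa using hinv _ h, fun h => hinv _ h⟩
      rw [← this, inv_pow]
      exact Set.inv_mem_inv.2 ha
  induction A, hA using Set.Finite.induction_on with
  | empty => exact ⟨1, le_rfl, Set.empty_subset _⟩
  | insert _ _ ih =>
    obtain ⟨c, hc, h⟩ := ih
    rename_i a _ _ _
    obtain ⟨d, hd⟩ := key a
    exact ⟨max c d, hc.trans (le_max_left _ _), Set.insert_subset (hmono (le_max_right _ _) hd)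
      (h.trans (hmono (le_max_left _ _)))⟩

theorem Set.Finite.monoid_pow {G : Type*} [Monoid G] {A : Set G} (hA : A.Finite) (m : ℕ) :
    (A ^ m).Finite := by
  induction m with
  | zero => simp
  | succ m ih => rw [pow_succ]; exact ih.mul hA

/-- A subgroup `N` of a group `G` of polynomial growth of degree `k` contains a power of each
element of `G` if its image under some homomorphism contains an embedded group that has polynomial
growth of the same degree `k`. Indeed, if no power of `g` were in `N`, the translates by the
powers of `g` of the balls of a finitely generated subgroup of `N` would be disjoint, so that `G`
would grow at least like `m ^ (k + 1)`. -/
theorem HasPolynomialGrowthOfDegree.exists_pow_mem {G G₀ P : Type*} [Group G] [Group G₀] [Group P]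
    {k : ℕ} (hG : HasPolynomialGrowthOfDegree G k) (hG₀ : HasPolynomialGrowthOfDegree G₀ k)
    {ι : G₀ →* P} (hι : Function.Injective ι) (Θ : G →* P) (N : Subgroup G)
    (hN : ∀ s, ∃ t ∈ N, Θ t = ι s) (g : G) : ∃ n : ℕ, 1 ≤ n ∧ g ^ n ∈ N := by
  by_contra! hg
  obtain ⟨S, hSfin, hSgen, _, β, -, hβ, hS⟩ := hG
  obtain ⟨S₀, hS₀fin, -, α, _, hα, -, hS₀⟩ := hG₀
  choose T hTN hTΘ using hN
  set B : Set G := {1} ∪ S ∪ S⁻¹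
  set B₀ : Set G₀ := {1} ∪ S₀ ∪ S₀⁻¹
  set A : Set G := {1} ∪ T '' S₀ ∪ (T '' S₀)⁻¹
  have hBfin : B.Finite := ((Set.finite_singleton _).union hSfin).union hSfin.inv
  have hAfin : A.Finite :=
    ((Set.finite_singleton _).union (hS₀fin.image T)).union (hS₀fin.image T).inv
  have hAN : A ⊆ N := by
    rintro x ((rfl | ⟨s, -, rfl⟩) | ⟨s, -, hs⟩)
    · exact N.one_mem
    · exact hTN s
    · rw [← inv_inv x, ← hs]
      exact N.inv_mem (hTN s)
  have hAmN : ∀ m : ℕ, A ^ m ⊆ N := by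
    intro m
    induction m with
    | zero => simp [N.one_mem]
    | succ m ih =>
      rw [pow_succ]
      rintro _ ⟨a, ha, b, hb, rfl⟩
      exact N.mul_mem (ih ha) (hAN hb)
  have hΘA : Θ '' A = ι '' B₀ := by
    simp only [A, B₀, Set.image_union, Set.image_singleton, map_one, Set.image_inv, Set.image_image,
      hTΘ]
  have hcardA : ∀ m : ℕ, (B₀ ^ m).ncard ≤ (A ^ m).ncard := by
    intro m
    rw [← Set.ncard_image_of_injective (B₀ ^ m) hι, Set.image_pow, ← hΘA, ← Set.image_pow]
    exact Set.ncard_image_le (hAfin.monoid_pow m)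
  obtain ⟨c, hc, hcsub⟩ := Set.Finite.exists_subset_pow_of_closure_eq_top (A := A ∪ {1, g}) hSgen
    (hAfin.union (by simp))
  -- `m + 1` disjoint translates of the ball of radius `m` in `N` fit into a ball of `G` whose
  -- radius is linear in `m`
  have hcount : ∀ m : ℕ, (m + 1) * (A ^ m).ncard ≤ (B ^ (2 * c * m)).ncard := by
    intro m
    have hinj : Set.InjOn (fun q : ℕ × G => g ^ q.1 * q.2)
        ((Finset.range (m + 1) : Set ℕ) ×ˢ (A ^ m)) := by
      have aux : ∀ (i j : ℕ) (a b : G), a ∈ N → b ∈ N → g ^ i * a = g ^ j * b → j ≤ i := by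
        intro i j a b ha hb h
        by_contra! hij
        obtain ⟨d, rfl⟩ := Nat.exists_eq_add_of_lt hij
        refine hg (d + 1) (by omega) ?_
        rw [add_assoc, pow_add, mul_assoc, mul_right_inj] at h
        have : g ^ (d + 1) = a * b⁻¹ := by rw [h]; simp
        rw [this]
        exact N.mul_mem ha (N.inv_mem hb)
      rintro ⟨i, a⟩ ⟨-, ha⟩ ⟨j, b⟩ ⟨-, hb⟩ h
      simp only at h ha hb
      have hij : i = j := le_antisymm (aux j i b a (hAmN m hb) (hAmN m ha) h.symm)
        (aux i j a b (hAmN m ha) (hAmN m hb) h)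
      subst hij
      simpa using h
    have hsub : (fun q : ℕ × G => g ^ q.1 * q.2) '' ((Finset.range (m + 1) : Set ℕ) ×ˢ (A ^ m)) ⊆
        B ^ (2 * c * m) := by
      rintro _ ⟨⟨i, a⟩, ⟨hi, ha⟩, rfl⟩
      have hgA : ({1, g} : Set G) ^ m ⊆ B ^ (c * m) := by
        rw [pow_mul]
        exact Set.pow_subset_pow_left (Set.subset_union_right.trans hcsub)
      have hAA : A ^ m ⊆ B ^ (c * m) := by
        rw [pow_mul]
        exact Set.pow_subset_pow_left (Set.subset_union_left.trans hcsub)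
      have hgi : g ^ i ∈ ({1, g} : Set G) ^ m := by
        have hi' : i ≤ m := by simpa [Nat.lt_succ_iff] using hi
        exact Set.pow_subset_pow_right (by simp) hi' (Set.pow_mem_pow (by simp))
      rw [show 2 * c * m = c * m + c * m by ring, pow_add]
      exact Set.mul_mem_mul (hgA hgi) (hAA ha)
    calc (m + 1) * (A ^ m).ncard
        = ((Finset.range (m + 1) : Set ℕ) ×ˢ (A ^ m)).ncard := by
          rw [Set.ncard_prod, Set.ncard_coe_finset, Finset.card_range]
      _ = _ := hinj.ncard_image.symm
      _ ≤ _ := Set.ncard_le_ncard hsub (hBfin.monoid_pow _)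
  obtain ⟨m, hm⟩ := exists_nat_gt (β * (2 * c : ℝ) ^ k / α)
  have hm0 : 0 < m := by
    have : (0 : ℝ) < m := lt_of_le_of_lt (by positivity) hm
    exact_mod_cast this
  have h1 : ((m + 1 : ℕ) : ℝ) * (α * (m : ℝ) ^ k) ≤ β * ((2 * c * m : ℕ) : ℝ) ^ k := by
    have hpos : 1 ≤ 2 * c * m := Nat.one_le_iff_ne_zero.2 (by positivity)
    calc ((m + 1 : ℕ) : ℝ) * (α * (m : ℝ) ^ k) ≤ ((m + 1 : ℕ) : ℝ) * ((A ^ m).ncard : ℝ) := by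
          refine mul_le_mul_of_nonneg_left ?_ (by positivity)
          exact (hS₀ m hm0).1.trans (by exact_mod_cast hcardA m)
      _ ≤ ((B ^ (2 * c * m)).ncard : ℝ) := by exact_mod_cast hcount m
      _ ≤ _ := (hS _ hpos).2
  rw [div_lt_iff₀ hα] at hm
  have hmk : (0 : ℝ) < (m : ℝ) ^ k := by positivity
  push_cast at h1
  rw [mul_pow] at h1
  nlinarith

/-! ### Paths and homotopies -/

theorem Path.subpath_mem_image_Icc {X : Type*} [TopologicalSpace X] {x y : X} (γ : Path x y)
    {t₀ t₁ : unitInterval} (h : t₀ ≤ t₁) (s : unitInterval) :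
    γ.subpath t₀ t₁ s ∈ γ '' Set.Icc t₀ t₁ := by
  rw [← Path.range_subpath_of_le γ _ _ h]
  exact Set.mem_range_self s

theorem Path.Homotopic.Quotient.mk_subpath_trans {X : Type*} [TopologicalSpace X] {x y : X}
    (γ : Path x y) (t₀ t₁ t₂ : unitInterval) :
    (mk (γ.subpath t₀ t₁)).trans (mk (γ.subpath t₁ t₂)) = mk (γ.subpath t₀ t₂) := by
  rw [← mk_trans]
  exact Path.Homotopic.Quotient.eq.2 ⟨Path.Homotopy.subpathTransSubpath γ _ _ _⟩

/-- A property of homotopy classes of paths that is stable under concatenation holds for all of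
them if each point has a neighbourhood such that it holds for the paths in this neighbourhood. -/
theorem Path.Homotopic.Quotient.induction_local {X : Type*} [TopologicalSpace X]
    {P : ∀ {x y : X}, Path.Homotopic.Quotient x y → Prop}
    (trans : ∀ {x y z : X} (γ : Path.Homotopic.Quotient x y) (δ : Path.Homotopic.Quotient y z),
      P γ → P δ → P (γ.trans δ))
    (small : ∀ x : X, ∃ U ∈ 𝓝 x, ∀ {p q : X} (γ : Path p q), (∀ t, γ t ∈ U) →
      P (Path.Homotopic.Quotient.mk γ)) {x y : X} (γ : Path.Homotopic.Quotient x y) : P γ := by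
  induction γ using Path.Homotopic.Quotient.ind with | mk γ
  choose U hU hP using small
  obtain ⟨t, ht0, ht, ⟨m, hm⟩, hc⟩ := exists_monotone_Icc_subset_open_cover_unitInterval
    (c := fun x => γ ⁻¹' interior (U x)) (fun x => isOpen_interior.preimage γ.continuous)
    (fun s _ => Set.mem_iUnion.2 ⟨γ s, mem_interior_iff_mem_nhds.2 (hU (γ s))⟩)
  have key : ∀ i, P (Path.Homotopic.Quotient.mk (γ.subpath 0 (t i))) := by
    intro i
    induction i with
    | zero =>
      rw [ht0, Path.subpath_self]
      exact hP (γ 0) _ fun _ => mem_of_mem_nhds (hU _)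
    | succ i ih =>
      rw [← Path.Homotopic.Quotient.mk_subpath_trans γ 0 (t i)]
      refine trans _ _ ih ?_
      obtain ⟨z, hz⟩ := hc i
      refine hP z _ fun s => interior_subset (s := U z) ?_
      obtain ⟨r, hr, hr'⟩ := γ.subpath_mem_image_Icc (ht (Nat.le_succ i)) s
      rw [← hr']
      exact hz hr
  have h := key m
  rw [hm m le_rfl, Path.subpath_zero_one] at h
  have cast : ∀ {a b : X} (δ : Path a b) {a' b' : X} (ha : a' = a) (hb : b' = b),
      P (Path.Homotopic.Quotient.mk (δ.cast ha hb)) → P (Path.Homotopic.Quotient.mk δ) := by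
    rintro a b δ _ _ rfl rfl hδ
    exact hδ
  exact cast γ _ _ h

/-- Any two paths in the subset `U` of `M` with the same end points are homotopic in `M`. -/
def IsHomotopicallySmall {M : Type*} [TopologicalSpace M] (U : Set M) : Prop :=
  ∀ {p q : M} (α β : Path p q), Set.range α ⊆ U → Set.range β ⊆ U →
    Path.Homotopic.Quotient.mk α = Path.Homotopic.Quotient.mk β

theorem IsHomotopicallySmall.of_convex {M E : Type*} [TopologicalSpace M] [AddCommGroup E]
    [Module ℝ E] [TopologicalSpace E] [ContinuousAdd E] [ContinuousSMul ℝ E]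
    (φ : OpenPartialHomeomorph M E) {C : Set E} (hC : Convex ℝ C) (hCφ : C ⊆ φ.target) :
    IsHomotopicallySmall (φ.symm '' C) := by
  intro p q α β hα hβ
  obtain ⟨c, hc, rfl⟩ : p ∈ φ.symm '' C := hα ⟨0, α.source⟩
  obtain ⟨d, hd, rfl⟩ : q ∈ φ.symm '' C := hα ⟨1, α.target⟩
  have : ContractibleSpace C := hC.contractibleSpace ⟨c, hc⟩
  let e : C(C, M) := ⟨fun c => φ.symm c,
    (φ.continuousOn_symm.mono hCφ).comp_continuous continuous_subtype_val fun c => c.2⟩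
  have lift : ∀ γ : Path (φ.symm c) (φ.symm d), Set.range γ ⊆ φ.symm '' C →
      ∃ γ' : Path (⟨c, hc⟩ : C) ⟨d, hd⟩, γ = γ'.map e.continuous := by
    intro γ hγ
    have h₁ : ∀ t, γ t ∈ φ.source ∧ φ (γ t) ∈ C := by
      intro t
      obtain ⟨c, hc, hct⟩ := hγ ⟨t, rfl⟩
      rw [← hct, φ.right_inv (hCφ hc)]
      exact ⟨φ.map_target (hCφ hc), hc⟩
    refine ⟨{ toFun := fun t => ⟨φ (γ t), (h₁ t).2⟩
              continuous_toFun := (φ.continuousOn.comp_continuous γ.continuous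
                fun t => (h₁ t).1).subtype_mk _
              source' := by simp [φ.right_inv (hCφ hc)]
              target' := by simp [φ.right_inv (hCφ hd)] }, ?_⟩
    ext t
    exact (φ.left_inv (h₁ t).1).symm
  obtain ⟨α', rfl⟩ := lift α hα
  obtain ⟨β', rfl⟩ := lift β hβ
  exact congrArg (fun γ => Path.Homotopic.Quotient.map γ e)
    (Path.Homotopic.Quotient.eq.2 (SimplyConnectedSpace.paths_homotopic α' β'))

theorem Path.Homotopic.Quotient.trans_map {X Y : Type*} [TopologicalSpace X] [TopologicalSpace Y]
    {x y z : X} (γ : Path.Homotopic.Quotient x y) (δ : Path.Homotopic.Quotient y z) (f : C(X, Y)) :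
    (γ.trans δ).map f = (γ.map f).trans (δ.map f) :=
  (FundamentalGroupoid.map f).map_comp (X := ⟨x⟩) (Y := ⟨y⟩) (Z := ⟨z⟩) γ δ

/-! ### Increasing germs of finite order -/

/-- A function on the line that is continuous at a fixed point and increasing near it is the
identity near this point if one of its iterates is. -/
theorem eventually_eq_of_iterate_eq {k : ℝ → ℝ} {s : ℝ} {J : Set ℝ} (hJ : J ∈ 𝓝 s)
    (hk : StrictMonoOn k J) (hc : ContinuousAt k s) (hs : k s = s) {n : ℕ} (hn : 1 ≤ n)
    (h : ∀ᶠ u in 𝓝 s, k^[n] u = u) : ∀ᶠ u in 𝓝 s, k u = u := by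
  have hiter : ∀ j, Filter.Tendsto k^[j] (𝓝 s) (𝓝 s) := by
    intro j
    induction j with
    | zero => exact Filter.tendsto_id
    | succ j ih =>
      rw [Function.iterate_succ]
      refine ih.comp ?_
      simpa only [ContinuousAt, hs] using hc
  have hall : ∀ᶠ u in 𝓝 s, ∀ j ∈ Finset.range (n + 1), k^[j] u ∈ J :=
    (Filter.eventually_all_finset _).2 fun j _ => (hiter j).eventually hJ
  filter_upwards [h, hall] with u hu hJu
  have hJu' : ∀ j, j ≤ n → k^[j] u ∈ J := fun j hj => hJu j (Finset.mem_range.2 (by omega))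
  rcases lt_trichotomy (k u) u with hlt | heq | hgt
  · have key : ∀ j, j + 1 ≤ n → k^[j + 1] u < k^[j] u := by
      intro j
      induction j with
      | zero => intro _; simpa using hlt
      | succ j ih =>
        intro hj
        simpa only [Function.iterate_succ_apply'] using
          hk (hJu' (j + 1) (by omega)) (hJu' j (by omega)) (ih (by omega))
    have key' : ∀ j, 1 ≤ j → j ≤ n → k^[j] u < u := by
      intro j hj
      induction j, hj using Nat.le_induction with
      | base => intro _; simpa using hlt
      | succ j _ ih => intro hj; exact (key j hj).trans (ih (by omega))
    exact absurd hu (key' n hn le_rfl).ne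
  · exact heq
  · have key : ∀ j, j + 1 ≤ n → k^[j] u < k^[j + 1] u := by
      intro j
      induction j with
      | zero => intro _; simpa using hgt
      | succ j ih =>
        intro hj
        simpa only [Function.iterate_succ_apply'] using
          hk (hJu' j (by omega)) (hJu' (j + 1) (by omega)) (ih (by omega))
    have key' : ∀ j, 1 ≤ j → j ≤ n → u < k^[j] u := by
      intro j hj
      induction j, hj using Nat.le_induction with
      | base => intro _; simpa using hgt
      | succ j _ ih => intro hj; exact (ih (by omega)).trans (key j hj)
    exact absurd hu (key' n hn le_rfl).ne'

namespace CodimOneFoliation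

variable {n : ℕ} {M : Type*} [TopologicalSpace M] {F : CodimOneFoliation n M}

/-! ### Transverse functions -/

theorem isFoliatedChart_of_mem_atlas {φ : ProductChart n M} (hφ : φ ∈ F.atlas) :
    F.IsFoliatedChart φ := fun ψ hψ x hx => F.compatible φ hφ ψ hψ x hx

/-- The transition is found through a chart of the atlas. -/
theorem IsFoliatedChart.exists_transition {φ ψ : ProductChart n M} (hφ : F.IsFoliatedChart φ)
    (hψ : F.IsFoliatedChart ψ) {x : M} (hxφ : x ∈ φ.source) (hxψ : x ∈ ψ.source) :
    ∃ h, IsTransverseTransition φ ψ x h := by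
  obtain ⟨χ, hχ, hxχ⟩ := F.covers x
  obtain ⟨g, -, -, hg⟩ := hφ χ hχ x ⟨hxφ, hxχ⟩
  obtain ⟨k, -, -, hk⟩ := hψ χ hχ x ⟨hxψ, hxχ⟩
  refine ⟨g.trans k.symm, hxφ, hxψ, ?_⟩
  filter_upwards [hg, hk] with y ⟨hy₁, hy₂⟩ ⟨hy₃, hy₄⟩
  have h : g (φ y).2 = k (ψ y).2 := by rw [← hy₂, ← hy₄]
  refine ⟨?_, ?_⟩
  · rw [OpenPartialHomeomorph.trans_source]
    exact ⟨hy₁, by simpa [h] using k.map_source hy₃⟩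
  · simp [h, k.left_inv hy₃]

variable (F) in
/-- A real function on `M` is transverse at `x` if near `x` it is the transverse coordinate of a
foliated chart followed by a local homeomorphism of `ℝ`. Nothing is asked of its values away
from `x`. -/
def IsTransverse (x : M) (f : M → ℝ) : Prop :=
  ∃ φ : ProductChart n M, F.IsFoliatedChart φ ∧ x ∈ φ.source ∧
    ∃ h : OpenPartialHomeomorph ℝ ℝ, (φ x).2 ∈ h.source ∧ ∀ᶠ y in 𝓝 x, f y = h (φ y).2

theorem continuousAt_transverseCoord (φ : ProductChart n M) {x : M} (hx : x ∈ φ.source) :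
    ContinuousAt (fun y => (φ y).2) x :=
  continuous_snd.continuousAt.comp (φ.continuousAt hx)

theorem map_nhds_transverseCoord (φ : ProductChart n M) {x : M} (hx : x ∈ φ.source) :
    Filter.map (fun y => (φ y).2) (𝓝 x) = 𝓝 (φ x).2 := by
  have : (fun y => (φ y).2) = Prod.snd ∘ φ := rfl
  rw [this, ← Filter.map_map, φ.map_nhds_eq hx]
  exact map_snd_nhds _

theorem IsFoliatedChart.isTransverse {φ : ProductChart n M} (hφ : F.IsFoliatedChart φ) {x : M}
    (hx : x ∈ φ.source) : F.IsTransverse x fun y => (φ y).2 :=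
  ⟨φ, hφ, hx, OpenPartialHomeomorph.refl ℝ, by simp, by simp⟩

namespace IsTransverse

variable {x : M} {f g : M → ℝ}

theorem congr (hf : F.IsTransverse x f) (h : g =ᶠ[𝓝 x] f) : F.IsTransverse x g := by
  obtain ⟨φ, hφ, hx, k, hk, e⟩ := hf
  exact ⟨φ, hφ, hx, k, hk, h.trans e⟩

theorem exists_eq_chart (hf : F.IsTransverse x f) {ψ : ProductChart n M}
    (hψ : F.IsFoliatedChart ψ) (hx : x ∈ ψ.source) :
    ∃ h : OpenPartialHomeomorph ℝ ℝ, (ψ x).2 ∈ h.source ∧ ∀ᶠ y in 𝓝 x, f y = h (ψ y).2 := by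
  obtain ⟨φ, hφ, hxφ, k, hk, e⟩ := hf
  obtain ⟨g, -, -, hg⟩ := hψ.exists_transition hφ hx hxφ
  refine ⟨g.trans k, ?_, ?_⟩
  · rw [OpenPartialHomeomorph.trans_source]
    have := hg.self_of_nhds
    exact ⟨this.1, by simpa [← this.2] using hk⟩
  · filter_upwards [e, hg] with y hy hy'
    simp [hy, hy'.2]

theorem eventually (hf : F.IsTransverse x f) : ∀ᶠ y in 𝓝 x, F.IsTransverse y f := by
  obtain ⟨φ, hφ, hxφ, k, hk, e⟩ := hf
  filter_upwards [φ.open_source.mem_nhds hxφ, e.eventually_nhds,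
    (continuousAt_transverseCoord φ hxφ).eventually (k.open_source.mem_nhds hk)]
    with y hy₁ hy₂ hy₃
  exact ⟨φ, hφ, hy₁, k, hy₃, hy₂⟩

theorem map_nhds (hf : F.IsTransverse x f) : Filter.map f (𝓝 x) = 𝓝 (f x) := by
  obtain ⟨φ, hφ, hxφ, k, hk, e⟩ := hf
  rw [Filter.map_congr (show f =ᶠ[𝓝 x] k ∘ fun y => (φ y).2 from e), ← Filter.map_map,
    map_nhds_transverseCoord φ hxφ, k.map_nhds_eq hk, e.self_of_nhds]

theorem continuousAt (hf : F.IsTransverse x f) : ContinuousAt f x := hf.map_nhds.le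

theorem comp (hf : F.IsTransverse x f) {k : OpenPartialHomeomorph ℝ ℝ} (hk : f x ∈ k.source) :
    F.IsTransverse x fun y => k (f y) := by
  obtain ⟨φ, hφ, hxφ, h, hh, e⟩ := hf
  refine ⟨φ, hφ, hxφ, h.trans k, ?_, ?_⟩
  · rw [OpenPartialHomeomorph.trans_source]
    exact ⟨hh, by simpa [← e.self_of_nhds] using hk⟩
  · filter_upwards [e] with y hy
    simp [hy]

theorem exists_eq_comp (hf : F.IsTransverse x f) (hg : F.IsTransverse x g) :
    ∃ k : OpenPartialHomeomorph ℝ ℝ, f x ∈ k.source ∧ ∀ᶠ y in 𝓝 x, g y = k (f y) := by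
  obtain ⟨φ, hφ, hxφ, h, hh, e⟩ := hf
  obtain ⟨k, hk, e'⟩ := hg.exists_eq_chart hφ hxφ
  refine ⟨h.symm.trans k, ?_, ?_⟩
  · rw [OpenPartialHomeomorph.trans_source, e.self_of_nhds]
    exact ⟨h.map_source hh, by simpa [h.left_inv hh] using hk⟩
  · filter_upwards [e, e', (continuousAt_transverseCoord φ hxφ).eventually
      (h.open_source.mem_nhds hh)] with y hy hy' hy''
    simp [hy, hy', h.left_inv hy'']

theorem eventually_eq_of_comp (hf : F.IsTransverse x f) {k l : ℝ → ℝ}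
    (h : ∀ᶠ y in 𝓝 x, k (f y) = l (f y)) : k =ᶠ[𝓝 (f x)] l := by
  rw [← hf.map_nhds]
  exact h

end IsTransverse

/-- The neighbourhoods of `x` in the leaf topology are those in the level set of any function that
is transverse at `x`. -/
theorem nhds_toFine {x : M} {f : M → ℝ} (hf : F.IsTransverse x f) :
    𝓝 (F.toFine x) = Filter.map F.toFine (𝓝 x ⊓ Filter.principal {y | f y = f x}) := by
  apply le_antisymm
  · intro U hU
    obtain ⟨φ, hφ, hx⟩ := F.covers x
    obtain ⟨h, hh, e⟩ := hf.exists_eq_chart (isFoliatedChart_of_mem_atlas hφ) hx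
    rw [Filter.mem_map, Filter.mem_inf_principal] at hU
    obtain ⟨V, hV, hVo, hxV⟩ := mem_nhds_iff.1 (Filter.inter_mem hU e)
    refine Filter.mem_of_superset (IsOpen.mem_nhds
      (TopologicalSpace.isOpen_generateFrom_of_mem ⟨V, hVo, φ, hφ, (φ x).2, rfl⟩)
      ⟨x, ⟨hxV, hx, rfl⟩, rfl⟩) ?_
    rintro _ ⟨y, ⟨hyV, -, hy⟩, rfl⟩
    have hy' := hV hyV
    refine hy'.1 ?_
    have h2 : f y = h (φ y).2 := hy'.2
    have h3 : f x = h (φ x).2 := e.self_of_nhds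
    change f y = f x
    rw [h2, h3, hy]
  · refine (TopologicalSpace.tendsto_nhds_generateFrom_iff (m := F.toFine)
      (f := 𝓝 x ⊓ Filter.principal {y | f y = f x}) (b := F.toFine x)).2 ?_
    rintro _ ⟨V, hV, φ, hφ, s, rfl⟩ ⟨x', ⟨hxV, hx, hs⟩, hxx⟩
    obtain rfl := F.toFine.injective hxx
    obtain ⟨k, -, e⟩ := hf.exists_eq_comp ((isFoliatedChart_of_mem_atlas hφ).isTransverse hx)
    rw [Filter.mem_inf_principal]
    filter_upwards [e, hV.mem_nhds hxV, φ.open_source.mem_nhds hx] with y hy hyV hyφ hy'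
    refine ⟨y, ⟨hyV, hyφ, ?_⟩, rfl⟩
    have h3 := e.self_of_nhds
    rw [hy, hy', ← h3, hs]

/-- To converge to `x` in the leaf topology is to converge in `M` inside the level set of a function
that is transverse at `x`. -/
theorem tendsto_toFine {A : Type*} {l : Filter A} {u : A → M} {x : M} {f : M → ℝ}
    (hf : F.IsTransverse x f) (hu : Filter.Tendsto u l (𝓝 x)) (h : ∀ᶠ a in l, f (u a) = f x) :
    Filter.Tendsto (fun a => F.toFine (u a)) l (𝓝 (F.toFine x)) := by
  rw [nhds_toFine hf]
  exact Filter.tendsto_map.comp (Filter.tendsto_inf.2 ⟨hu, Filter.tendsto_principal.2 h⟩)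

/-- A transverse function is constant on a neighbourhood in the leaf. -/
theorem eventually_eq_fine {x : F.FineSpace} {f : M → ℝ}
    (hf : F.IsTransverse (F.toFine.symm x) f) :
    ∀ᶠ y in 𝓝 x, f (F.toFine.symm y) = f (F.toFine.symm x) := by
  have h := nhds_toFine hf
  rw [Equiv.apply_symm_apply] at h
  rw [h, Filter.eventually_map, Filter.eventually_inf_principal]
  exact Filter.Eventually.of_forall fun y hy => by simpa using hy

/-! ### The covering space of transverse germs -/

variable (F) in
/-- A germ of a transverse function at a point of `M`. The germ is encoded as the set of all
functions `M → ℝ` that represent it. -/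
@[ext] structure TransverseGerm where
  /-- the point at which the germ is taken -/
  pt : F.FineSpace
  /-- the functions that represent the germ -/
  reps : Set (M → ℝ)
  exists_rep : ∃ f, F.IsTransverse (F.toFine.symm pt) f ∧
    reps = {g | g =ᶠ[𝓝 (F.toFine.symm pt)] f}

/-- The germ of `f` at `x`. -/
def germ (x : F.FineSpace) (f : M → ℝ) (hf : F.IsTransverse (F.toFine.symm x) f) :
    F.TransverseGerm := ⟨x, {g | g =ᶠ[𝓝 (F.toFine.symm x)] f}, f, hf, rfl⟩

theorem germ_eq_germ_iff {x : F.FineSpace} {f g : M → ℝ} {hf hg} :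
    germ x f hf = germ x g hg ↔ f =ᶠ[𝓝 (F.toFine.symm x)] g := by
  constructor
  · intro h
    have h' : f ∈ (germ x f hf).reps := Filter.EventuallyEq.rfl
    rw [h] at h'
    exact h'
  · intro h
    ext1
    · rfl
    · ext k
      exact ⟨fun hk => Filter.EventuallyEq.trans hk h,
        fun hk => Filter.EventuallyEq.trans hk h.symm⟩

theorem TransverseGerm.exists_eq_germ (e : F.TransverseGerm) : ∃ f hf, e = germ e.pt f hf := by
  obtain ⟨f, hf, h⟩ := e.exists_rep
  exact ⟨f, hf, TransverseGerm.ext rfl h⟩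

theorem TransverseGerm.eq_germ (e : F.TransverseGerm) {f : M → ℝ} (h : f ∈ e.reps) :
    ∃ hf, e = germ e.pt f hf := by
  obtain ⟨g, hg, he⟩ := e.exists_eq_germ
  rw [he] at h
  have h' : f =ᶠ[𝓝 (F.toFine.symm e.pt)] g := h
  refine ⟨hg.congr h', he.trans (germ_eq_germ_iff.2 h'.symm)⟩

/-- The topology on the space of germs in which the sections defined by transverse functions
over open subsets of the leaves are open. -/
instance : TopologicalSpace F.TransverseGerm :=
  TopologicalSpace.generateFrom
    {N | ∃ V : Set F.FineSpace, IsOpen V ∧ ∃ f : M → ℝ, N = {e | e.pt ∈ V ∧ f ∈ e.reps}}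

theorem TransverseGerm.continuous_pt : Continuous (TransverseGerm.pt : F.TransverseGerm → _) := by
  refine continuous_def.2 fun V hV => isOpen_iff_forall_mem_open.2 fun e he => ?_
  obtain ⟨f, hf, h⟩ := e.exists_eq_germ
  refine ⟨{e | e.pt ∈ V ∧ f ∈ e.reps}, fun _ h => h.1,
    TopologicalSpace.isOpen_generateFrom_of_mem ⟨V, hV, f, rfl⟩, he, ?_⟩
  rw [h]
  exact Filter.EventuallyEq.rfl

/-- The germs of one transverse function along a continuous map into the leaves depend
continuously on the parameter. -/
theorem continuous_germ {A : Type*} [TopologicalSpace A] {u : A → F.FineSpace} (hu : Continuous u)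
    {f : M → ℝ} (hf : ∀ a, F.IsTransverse (F.toFine.symm (u a)) f) :
    Continuous fun a => germ (u a) f (hf a) := by
  refine continuous_generateFrom_iff.2 ?_
  rintro _ ⟨V, hV, g, rfl⟩
  refine (hV.preimage hu).inter ?_
  exact (isOpen_setOfPred_eventually_nhds (p := fun y => g y = f y)).preimage
    (F.continuous_toFine_symm.comp hu)

/-- The projection of the space of germs is a covering map for the leaf topology. Its monodromy is
the holonomy of the foliation. -/
theorem isCoveringMap_pt : IsCoveringMap (TransverseGerm.pt : F.TransverseGerm → _) := by
  intro x
  obtain ⟨φ, hφ, hx⟩ := F.covers (F.toFine.symm x)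
  have hφ' := isFoliatedChart_of_mem_atlas hφ
  set s := (φ (F.toFine.symm x)).2 with hs
  let U : Set F.FineSpace := F.toFine '' {y | y ∈ Set.univ ∧ y ∈ φ.source ∧ (φ y).2 = s}
  have hU : IsOpen U :=
    TopologicalSpace.isOpen_generateFrom_of_mem ⟨Set.univ, isOpen_univ, φ, hφ, s, rfl⟩
  have hUs : ∀ y ∈ U, F.toFine.symm y ∈ φ.source ∧ (φ (F.toFine.symm y)).2 = s := by
    rintro _ ⟨y, ⟨-, hy⟩, rfl⟩
    simpa using hy
  have hxU : x ∈ U := ⟨F.toFine.symm x, ⟨trivial, hx, rfl⟩, by simp⟩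
  let I := {κ : Set (ℝ → ℝ) // ∃ h : OpenPartialHomeomorph ℝ ℝ, s ∈ h.source ∧
    κ = {k | k =ᶠ[𝓝 s] h}}
  let _ : TopologicalSpace I := ⊥
  have : DiscreteTopology I := ⟨rfl⟩
  choose h hhs hκ using fun κ : I => κ.2
  have htr : ∀ (κ : I) (y : U),
      F.IsTransverse (F.toFine.symm y.1) fun z => h κ (φ z).2 := fun κ y =>
    (hφ'.isTransverse (hUs y y.2).1).comp (by rw [(hUs y y.2).2]; exact hhs κ)
  -- germs at a point of the plaque `U` correspond to germs of local homeomorphisms at `s`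
  have hcomp : ∀ (y : U) (k l : ℝ → ℝ), ((fun z => k (φ z).2) =ᶠ[𝓝 (F.toFine.symm y.1)]
      fun z => l (φ z).2) ↔ k =ᶠ[𝓝 s] l := fun y k l => by
    rw [← (hUs y y.2).2, ← map_nhds_transverseCoord φ (hUs y y.2).1]
    exact Iff.rfl
  have hmem : ∀ e : TransverseGerm.pt ⁻¹' U, ∃ g : OpenPartialHomeomorph ℝ ℝ, s ∈ g.source ∧
      {k : ℝ → ℝ | (fun z => k (φ z).2) ∈ e.1.reps} = {k | k =ᶠ[𝓝 s] g} := by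
    rintro ⟨e, he⟩
    obtain ⟨f, hf, hef⟩ := e.exists_eq_germ
    obtain ⟨g, hg, hfg⟩ := hf.exists_eq_chart hφ' (hUs _ he).1
    rw [(hUs _ he).2] at hg
    refine ⟨g, hg, ?_⟩
    ext k
    change (fun z => k (φ z).2) ∈ e.reps ↔ k =ᶠ[𝓝 s] g
    rw [hef]
    refine Iff.trans ⟨fun h => ?_, fun h => ?_⟩ (hcomp ⟨_, he⟩ k g)
    · exact Filter.EventuallyEq.trans h hfg
    · exact Filter.EventuallyEq.trans h (Filter.EventuallyEq.symm hfg)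
  let H : TransverseGerm.pt ⁻¹' U ≃ₜ U × I :=
    { toFun := fun e => (⟨e.1.pt, e.2⟩, ⟨{k | (fun z => k (φ z).2) ∈ e.1.reps}, hmem e⟩)
      invFun := fun q => ⟨germ q.1.1 (fun z => h q.2 (φ z).2) (htr q.2 q.1), q.1.2⟩
      left_inv := by
        intro e
        apply Subtype.ext
        set κ : I := ⟨{k | (fun z => k (φ z).2) ∈ e.1.reps}, hmem e⟩ with hκe
        have h1 : (h κ : ℝ → ℝ) ∈ κ.1 := by rw [hκ κ]; exact Filter.EventuallyEq.rfl
        exact (e.1.eq_germ (f := fun z => h κ (φ z).2) h1).choose_spec.symm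
      right_inv := by
        rintro ⟨y, κ⟩
        refine Prod.ext rfl (Subtype.ext ?_)
        conv_rhs => rw [hκ κ]
        ext k
        exact hcomp y k (h κ)
      continuous_toFun := by
        refine Continuous.prodMk ?_ ?_
        · exact Continuous.subtype_mk
            (TransverseGerm.continuous_pt.comp continuous_subtype_val) _
        · refine continuous_discrete_rng.2 fun κ => ?_
          have : IsOpen {e : F.TransverseGerm | e.pt ∈ U ∧ (fun z => h κ (φ z).2) ∈ e.reps} :=
            TopologicalSpace.isOpen_generateFrom_of_mem ⟨U, hU, _, rfl⟩
          convert this.preimage continuous_subtype_val using 1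
          ext e
          simp only [Set.mem_preimage, Set.mem_singleton_iff, Set.mem_ofPred_eq]
          refine ⟨fun he => ⟨e.2, ?_⟩, fun he => Subtype.ext ?_⟩
          · have h1 : (h κ : ℝ → ℝ) ∈ κ.1 := by rw [hκ κ]; exact Filter.EventuallyEq.rfl
            exact (Set.ext_iff.1 (congrArg Subtype.val he) (h κ)).2 h1
          · obtain ⟨hf, h2⟩ := e.1.eq_germ he.2
            rw [hκ κ]
            ext k
            change (fun z => k (φ z).2) ∈ e.1.reps ↔ k =ᶠ[𝓝 s] h κ
            rw [h2]
            exact hcomp ⟨_, e.2⟩ k (h κ)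
      continuous_invFun := by
        refine continuous_prod_of_discrete_right.2 fun κ => ?_
        exact Continuous.subtype_mk (continuous_germ continuous_subtype_val fun y => htr κ y) _ }
  exact IsEvenlyCovered.to_isEvenlyCovered_preimage (I := I)
    ⟨inferInstance, U, hxU, hU, hU.preimage TransverseGerm.continuous_pt, H, fun _ => rfl⟩

/-! ### Continuation of germs along paths in the leaves -/

/-- The continuation of the germ of `f` along the homotopy class `γ` of paths in a leaf is the germ
of `g`. This includes that both functions are transverse at the respective end point. -/
def Continues {x y : F.FineSpace} (γ : Path.Homotopic.Quotient x y) (f g : M → ℝ) : Prop :=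
  ∃ (hf : F.IsTransverse (F.toFine.symm x) f) (hg : F.IsTransverse (F.toFine.symm y) g),
    isCoveringMap_pt.monodromy γ ⟨germ x f hf, rfl⟩ = ⟨germ y g hg, rfl⟩

namespace Continues

variable {x y z : F.FineSpace} {γ : Path.Homotopic.Quotient x y} {δ : Path.Homotopic.Quotient y z}
  {f g k : M → ℝ}

theorem left (h : Continues γ f g) : F.IsTransverse (F.toFine.symm x) f := h.1

theorem right (h : Continues γ f g) : F.IsTransverse (F.toFine.symm y) g := h.2.1

theorem trans (h : Continues γ f g) (h' : Continues δ g k) : Continues (γ.trans δ) f k := by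
  obtain ⟨hf, hg, h⟩ := h
  obtain ⟨_, hk, h'⟩ := h'
  exact ⟨hf, hk, by rw [IsCoveringMap.monodromy_trans_apply, h, h']⟩

theorem _root_.CodimOneFoliation.IsTransverse.exists_continues
    (hf : F.IsTransverse (F.toFine.symm x) f) (γ : Path.Homotopic.Quotient x y) :
    ∃ g, Continues γ f g := by
  have key : ∀ e : TransverseGerm.pt ⁻¹' {y}, ∃ g hg, e = ⟨germ y g hg, rfl⟩ := by
    rintro ⟨e, rfl⟩
    obtain ⟨g, hg, h⟩ := e.exists_eq_germ
    exact ⟨g, hg, Subtype.ext h⟩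
  obtain ⟨g, hg, h⟩ := key (isCoveringMap_pt.monodromy γ ⟨germ x f hf, rfl⟩)
  exact ⟨g, hf, hg, h⟩

theorem eventuallyEq (h : Continues γ f g) (h' : Continues γ f k) :
    g =ᶠ[𝓝 (F.toFine.symm y)] k := by
  obtain ⟨hf, hg, h⟩ := h
  obtain ⟨_, hk, h'⟩ := h'
  exact (germ_eq_germ_iff (hf := hg) (hg := hk)).1 (congrArg Subtype.val (h.symm.trans h'))

theorem congr (h : Continues γ f g) {f' g' : M → ℝ} (hf : f' =ᶠ[𝓝 (F.toFine.symm x)] f)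
    (hg : g' =ᶠ[𝓝 (F.toFine.symm y)] g) : Continues γ f' g' := by
  obtain ⟨hf', hg', h⟩ := h
  refine ⟨hf'.congr hf, hg'.congr hg, ?_⟩
  have e₁ := germ_eq_germ_iff (hf := hf'.congr hf) (hg := hf') |>.2 hf
  have e₂ := germ_eq_germ_iff (hf := hg'.congr hg) (hg := hg') |>.2 hg
  simp only [e₁, e₂, h]

theorem exists_of_trans (h : Continues (γ.trans δ) f g) :
    ∃ l, Continues γ f l ∧ Continues δ l g := by
  obtain ⟨l, hl⟩ := h.left.exists_continues γ
  obtain ⟨l', hl'⟩ := hl.right.exists_continues δ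
  exact ⟨l, hl, hl'.congr (Filter.EventuallyEq.refl _ l) ((hl.trans hl').eventuallyEq h).symm⟩

theorem symm (h : Continues γ f g) : Continues γ.symm g f := by
  obtain ⟨hf, hg, h⟩ := h
  refine ⟨hg, hf, ?_⟩
  rw [← h, ← IsCoveringMap.monodromy_trans_apply, Path.Homotopic.Quotient.trans_symm,
    IsCoveringMap.monodromy_refl, id]

/-- A function that is transverse all along a path is continued by itself. -/
theorem of_forall {γ : Path x y} (h : ∀ t, F.IsTransverse (F.toFine.symm (γ t)) f) :
    Continues (.mk γ) f f := by
  have hx : F.IsTransverse (F.toFine.symm x) f := by simpa using h 0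
  have hy : F.IsTransverse (F.toFine.symm y) f := by simpa using h 1
  let Γ : Path (germ x f hx) (germ y f hy) :=
    { toFun := fun t => germ (γ t) f (h t)
      continuous_toFun := continuous_germ γ.continuous h
      source' := by simp
      target' := by simp }
  exact ⟨hx, hy, isCoveringMap_pt.monodromy_map (.mk Γ)⟩

theorem refl (hf : F.IsTransverse (F.toFine.symm x) f) :
    Continues (Path.Homotopic.Quotient.refl x) f f :=
  of_forall (γ := Path.refl x) fun _ => hf

end Continues

/-- The points of a leaf that are close to `x` for the leaf topology lie in the domain of a given
chart at `x` and have the same transverse coordinate as `x`. -/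
theorem IsFoliatedChart.exists_nhds_coord_eq {φ : ProductChart n M} (hφ : F.IsFoliatedChart φ)
    {x : F.FineSpace} (hx : F.toFine.symm x ∈ φ.source) :
    ∃ U ∈ 𝓝 x, ∀ y ∈ U, F.toFine.symm y ∈ φ.source ∧
      (φ (F.toFine.symm y)).2 = (φ (F.toFine.symm x)).2 := by
  refine ⟨{y | _}, ?_, fun y hy => hy⟩
  exact ((F.continuous_toFine_symm.continuousAt).eventually (φ.open_source.mem_nhds hx)).and
    (eventually_eq_fine (hφ.isTransverse hx))

theorem Continues.of_chart {φ : ProductChart n M} (hφ : F.IsFoliatedChart φ) {x y : F.FineSpace}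
    {γ : Path x y} (hγ : ∀ t, F.toFine.symm (γ t) ∈ φ.source ∧
      (φ (F.toFine.symm (γ t))).2 = (φ (F.toFine.symm x)).2)
    (h : OpenPartialHomeomorph ℝ ℝ) (hh : (φ (F.toFine.symm x)).2 ∈ h.source) :
    Continues (.mk γ) (fun z => h (φ z).2) fun z => h (φ z).2 :=
  .of_forall fun t => (hφ.isTransverse (hγ t).1).comp (by rw [(hγ t).2]; exact hh)

/-- Continuation preserves the value of a germ and commutes with local homeomorphisms of `ℝ`. Along
short paths both hold since the germs are those of one function of a transverse coordinate. -/
theorem Continues.comp_and_eq {x y : F.FineSpace} (γ : Path.Homotopic.Quotient x y) :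
    ∀ {f g : M → ℝ}, Continues γ f g → g (F.toFine.symm y) = f (F.toFine.symm x) ∧
      ∀ k : OpenPartialHomeomorph ℝ ℝ, f (F.toFine.symm x) ∈ k.source →
        Continues γ (fun z => k (f z)) fun z => k (g z) := by
  refine Path.Homotopic.Quotient.induction_local (X := F.FineSpace) (P := fun {x y} γ =>
    ∀ {f g : M → ℝ}, Continues γ f g → g (F.toFine.symm y) = f (F.toFine.symm x) ∧
      ∀ k : OpenPartialHomeomorph ℝ ℝ, f (F.toFine.symm x) ∈ k.source →
        Continues γ (fun z => k (f z)) fun z => k (g z)) ?_ ?_ γ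
  · intro x y z γ δ hγ hδ f g h
    obtain ⟨l, hl, h'⟩ := h.exists_of_trans
    obtain ⟨e₁, c₁⟩ := hγ hl
    obtain ⟨e₂, c₂⟩ := hδ h'
    exact ⟨e₂.trans e₁, fun k hk => (c₁ k hk).trans (c₂ k (by rwa [e₁]))⟩
  · intro x
    obtain ⟨φ, hφ, hx⟩ := F.covers (F.toFine.symm x)
    have hφ' := isFoliatedChart_of_mem_atlas hφ
    obtain ⟨U, hU, hUφ⟩ := hφ'.exists_nhds_coord_eq hx
    refine ⟨U, hU, fun {p q} γ hγ f g h => ?_⟩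
    have hp : p ∈ U := by simpa using hγ 0
    have hq : q ∈ U := by simpa using hγ 1
    have hγ' : ∀ t, F.toFine.symm (γ t) ∈ φ.source ∧
        (φ (F.toFine.symm (γ t))).2 = (φ (F.toFine.symm p)).2 := fun t =>
      ⟨(hUφ _ (hγ t)).1, (hUφ _ (hγ t)).2.trans (hUφ _ hp).2.symm⟩
    obtain ⟨l, hl, e⟩ := h.left.exists_eq_chart hφ' (hUφ _ hp).1
    have e' :=
      ((Continues.of_chart hφ' hγ' l hl).congr e (Filter.EventuallyEq.refl _ _)).eventuallyEq h
    have ep : f (F.toFine.symm p) = l (φ (F.toFine.symm p)).2 := e.self_of_nhds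
    have eq' : l (φ (F.toFine.symm q)).2 = g (F.toFine.symm q) := e'.self_of_nhds
    refine ⟨by rw [← eq', ep, (hUφ _ hq).2, (hUφ _ hp).2], fun k hk => ?_⟩
    have hlk : (φ (F.toFine.symm p)).2 ∈ (l.trans k).source := by
      rw [OpenPartialHomeomorph.trans_source]
      exact ⟨hl, by simpa [← ep] using hk⟩
    refine (Continues.of_chart hφ' hγ' (l.trans k) hlk).congr ?_ ?_
    · filter_upwards [e] with z hz
      simp [hz]
    · filter_upwards [e'] with z hz
      simp [← hz]

theorem Continues.apply_eq {x y : F.FineSpace} {γ : Path.Homotopic.Quotient x y} {f g : M → ℝ}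
    (h : Continues γ f g) : g (F.toFine.symm y) = f (F.toFine.symm x) := (comp_and_eq γ h).1

theorem Continues.comp {x y : F.FineSpace} {γ : Path.Homotopic.Quotient x y} {f g : M → ℝ}
    (h : Continues γ f g) {k : OpenPartialHomeomorph ℝ ℝ} (hk : f (F.toFine.symm x) ∈ k.source) :
    Continues γ (fun z => k (f z)) fun z => k (g z) := (comp_and_eq γ h).2 k hk

/-! ### Holonomy maps -/

/-- Holonomy maps compute the continuation of germs: the transverse coordinate at the end of the
path is the continuation of the composite of the holonomy map with the transverse coordinate at its
start. -/
theorem IsHolonomyMap.continues {x y : M} {γ : Path (F.toFine x) (F.toFine y)}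
    {φ ψ : ProductChart n M} {h : OpenPartialHomeomorph ℝ ℝ} (H : F.IsHolonomyMap γ φ ψ h) :
    x ∈ φ.source ∧ (φ x).2 ∈ h.source ∧
      Continues (.mk γ) (fun z => h (φ z).2) fun z => (ψ z).2 := by
  obtain ⟨m, t, χ, g, ht, ht0, htm, rfl, rfl, hχ, hs, hg, rfl⟩ := H
  have hm : 0 < m := by
    rcases Nat.eq_zero_or_pos m with rfl | hm
    · exact absurd (ht0.symm.trans htm) (by simp)
    · exact hm
  have h0 : F.toFine.symm (γ 0) ∈ (χ 0).source :=
    hs 0 hm 0 ⟨ht0.le, unitInterval.nonneg'⟩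
  have hf : ∀ {i}, i ≤ m → F.IsFoliatedChart (χ i) := fun hi =>
    isFoliatedChart_of_mem_atlas (hχ _ hi)
  have key : ∀ i ≤ m, ((χ 0) (F.toFine.symm (γ 0))).2 ∈ (composeTransitions g i).source ∧
      Continues (.mk (γ.subpath 0 (t i))) (fun z => composeTransitions g i ((χ 0) z).2)
        fun z => ((χ i) z).2 := by
    intro i
    induction i with
    | zero =>
      intro _
      refine ⟨by simp [composeTransitions], ?_⟩
      rw [ht0, Path.subpath_self]
      exact Continues.refl ((hf (Nat.zero_le _)).isTransverse h0)
    | succ i ih =>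
      intro hi
      obtain ⟨ih₁, ih₂⟩ := ih (Nat.le_of_succ_le hi)
      have h₁ : Continues (.mk (γ.subpath (t i) (t (i + 1)))) (fun z => ((χ i) z).2)
          fun z => ((χ i) z).2 := by
        refine .of_forall fun s => (hf (Nat.le_of_succ_le hi)).isTransverse ?_
        obtain ⟨r, hr, hr'⟩ := γ.subpath_mem_image_Icc (ht (Nat.le_succ i)) s
        rw [← hr']
        exact hs i hi r hr
      have h₂ := ih₂.trans h₁
      rw [Path.Homotopic.Quotient.mk_subpath_trans] at h₂
      obtain ⟨-, -, hgi⟩ := hg i hi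
      have h₄ : composeTransitions g i ((χ 0) (F.toFine.symm (γ 0))).2 ∈ (g i).source := by
        rw [← h₂.apply_eq]
        exact hgi.self_of_nhds.1
      refine ⟨?_, (h₂.comp h₄).congr (by simp [composeTransitions]) ?_⟩
      · rw [composeTransitions, OpenPartialHomeomorph.trans_source]
        exact ⟨ih₁, h₄⟩
      · filter_upwards [hgi] with z hz using hz.2
  obtain ⟨h₁, h₂⟩ := key m le_rfl
  rw [htm, Path.subpath_zero_one] at h₂
  have cast : ∀ {a b : F.FineSpace} (δ : Path a b) {a' b' : F.FineSpace} (ha : a' = a) (hb : b' = b)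
      (f g : M → ℝ), Continues (.mk (δ.cast ha hb)) f g → Continues (.mk δ) f g := by
    rintro a b δ _ _ rfl rfl f g h
    exact h
  rw [γ.source] at h0 h₁
  exact ⟨by simpa using h0, by simpa using h₁, cast _ _ _ _ _ h₂⟩

/-- Each path in a leaf has a holonomy map, by compactness of the path. -/
theorem exists_isHolonomyMap {x y : M} (γ : Path (F.toFine x) (F.toFine y))
    {φ ψ : ProductChart n M} (hφ : φ ∈ F.atlas) (hx : x ∈ φ.source) (hψ : ψ ∈ F.atlas)
    (hy : y ∈ ψ.source) : ∃ h, F.IsHolonomyMap γ φ ψ h := by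
  have hcont : Continuous fun s => F.toFine.symm (γ s) := F.continuous_toFine_symm.comp γ.continuous
  obtain ⟨t, ht0, ht, ⟨m, hm⟩, hc⟩ := exists_monotone_Icc_subset_open_cover_unitInterval
    (c := fun φ : F.atlas => (fun s => F.toFine.symm (γ s)) ⁻¹' φ.1.source)
    (fun φ => φ.1.open_source.preimage hcont) (fun s _ => by
      obtain ⟨φ, hφ, h⟩ := F.covers (F.toFine.symm (γ s))
      exact Set.mem_iUnion.2 ⟨⟨φ, hφ⟩, h⟩)
  choose χ hχ using hc
  -- a piece of length zero in front makes `φ` the first chart of the chain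
  let t' : ℕ → unitInterval := fun i => Nat.casesOn i 0 t
  let χ' : ℕ → ProductChart n M := fun i => Nat.casesOn i φ fun i => if i < m then χ i else ψ
  have hat : ∀ i, χ' i ∈ F.atlas := by
    rintro (_ | i)
    · exact hφ
    · change (if i < m then (χ i : ProductChart n M) else ψ) ∈ F.atlas
      split_ifs
      exacts [(χ i).2, hψ]
  have hsrc : ∀ i < m + 1, ∀ s ∈ Set.Icc (t' i) (t' (i + 1)),
      F.toFine.symm (γ s) ∈ (χ' i).source := by
    rintro (_ | i) hi s hs
    · have hs0 : s = 0 := le_antisymm (hs.2.trans ht0.le) unitInterval.nonneg'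
      rw [hs0, γ.source]
      exact hx
    · have hi' : i < m := by omega
      change _ ∈ (if i < m then (χ i : ProductChart n M) else ψ).source
      rw [if_pos hi']
      exact hχ i hs
  have hmono : Monotone t' := by
    refine monotone_nat_of_le_succ ?_
    rintro (_ | i)
    · exact unitInterval.nonneg'
    · exact ht (Nat.le_succ i)
  have htr : ∀ i, ∃ g, i < m + 1 →
      IsTransverseTransition (χ' i) (χ' (i + 1)) (F.toFine.symm (γ (t' (i + 1)))) g := by
    intro i
    by_cases hi : i < m + 1
    · have h₁ := hsrc i hi _ ⟨hmono (Nat.le_succ i), le_rfl⟩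
      have h₂ : F.toFine.symm (γ (t' (i + 1))) ∈ (χ' (i + 1)).source := by
        by_cases him : i < m
        · exact hsrc (i + 1) (by omega) _ ⟨le_rfl, hmono (Nat.le_succ (i + 1))⟩
        · change F.toFine.symm (γ (t i)) ∈ (if i < m then (χ i : ProductChart n M) else ψ).source
          rw [if_neg him, hm i (by omega), γ.target]
          exact hy
      obtain ⟨g, hg⟩ := F.compatible _ (hat i) _ (hat (i + 1)) _ ⟨h₁, h₂⟩
      exact ⟨g, fun _ => hg⟩
    · exact ⟨OpenPartialHomeomorph.refl ℝ, fun h => absurd h hi⟩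
  choose g hg using htr
  refine ⟨_, m + 1, t', χ', g, hmono, rfl, hm m le_rfl, rfl, ?_, fun i _ => hat i, hsrc, hg, rfl⟩
  exact if_neg (lt_irrefl m)

/-! ### Pushing paths to nearby leaves -/

variable (F) in
/-- The identity map from `M` with the leaf topology to `M`. -/
def fineToM : C(F.FineSpace, M) := ⟨F.toFine.symm, F.continuous_toFine_symm⟩

/-- Small boxes in a chart: they are path connected and homotopically small, and the slices by the
transverse coordinate are path connected. -/
theorem exists_box (φ : ProductChart n M) {x : M} (hx : x ∈ φ.source) {W : Set M} (hW : W ∈ 𝓝 x) :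
    ∃ B ∈ 𝓝 x, B ⊆ W ∧ B ⊆ φ.source ∧ IsHomotopicallySmall B ∧ ∀ p ∈ B, ∀ q ∈ B,
      ∃ δ : Path p q, Set.range δ ⊆ B ∧
        ((φ p).2 = (φ q).2 → ∀ t, (φ (δ t)).2 = (φ p).2) := by
  have h₁ : φ.target ∩ φ.symm ⁻¹' W ∈ 𝓝 (φ x) := by
    refine Filter.inter_mem (φ.open_target.mem_nhds (φ.map_source hx)) ?_
    refine (φ.symm.continuousAt (φ.map_source hx)).preimage_mem_nhds ?_
    rwa [φ.left_inv hx]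
  obtain ⟨r, hr, hball⟩ := Metric.mem_nhds_iff.1 h₁
  set C := Metric.ball (φ x) r
  have hC : Convex ℝ C := convex_ball _ _
  have hCt : C ⊆ φ.target := fun c hc => (hball hc).1
  refine ⟨φ.symm '' C, ?_, ?_, ?_, IsHomotopicallySmall.of_convex φ hC hCt, ?_⟩
  · have := φ.symm.image_mem_nhds (φ.map_source hx) (Metric.ball_mem_nhds (φ x) hr)
    rwa [φ.left_inv hx] at this
  · rintro _ ⟨c, hc, rfl⟩
    exact (hball hc).2
  · rintro _ ⟨c, hc, rfl⟩
    exact φ.map_target (hCt hc)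
  · rintro _ ⟨c, hc, rfl⟩ _ ⟨d, hd, rfl⟩
    have hseg : ∀ t : unitInterval, AffineMap.lineMap c d (t : ℝ) ∈ C := fun t =>
      hC.lineMap_mem hc hd t.2
    refine ⟨{ toFun := fun t => φ.symm (AffineMap.lineMap c d (t : ℝ))
              continuous_toFun := φ.continuousOn_symm.comp_continuous
                (AffineMap.lineMap_continuous.comp continuous_subtype_val) fun t => hCt (hseg t)
              source' := by simp
              target' := by simp }, ?_, fun h t => ?_⟩
    · rintro _ ⟨t, rfl⟩
      exact ⟨_, hseg t, rfl⟩
    · rw [φ.right_inv (hCt hc), φ.right_inv (hCt hd)] at h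
      change (φ (φ.symm (AffineMap.lineMap c d (t : ℝ)))).2 = _
      rw [φ.right_inv (hCt (hseg t)), φ.right_inv (hCt hc)]
      simp [AffineMap.lineMap_apply, h]

theorem exists_homotopicallySmall_nhds (F : CodimOneFoliation n M) (x : M) :
    ∃ B ∈ 𝓝 x, IsHomotopicallySmall B ∧
      ∀ p ∈ B, ∀ q ∈ B, ∃ δ : Path p q, Set.range δ ⊆ B := by
  obtain ⟨φ, -, hx⟩ := F.covers x
  obtain ⟨B, hB, -, -, hs, hp⟩ := exists_box φ hx Filter.univ_mem
  exact ⟨B, hB, hs, fun p hpB q hqB => (hp p hpB q hqB).imp fun _ h => h.1⟩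

variable (F) in
/-- A chosen path connected and homotopically small neighbourhood of `x`. -/
noncomputable def box (x : M) : Set M := (F.exists_homotopicallySmall_nhds x).choose

variable (F) in
theorem box_mem_nhds (x : M) : F.box x ∈ 𝓝 x := (F.exists_homotopicallySmall_nhds x).choose_spec.1

theorem isHomotopicallySmall_box (x : M) : IsHomotopicallySmall (F.box x) :=
  (F.exists_homotopicallySmall_nhds x).choose_spec.2.1

theorem exists_path_box {x z : M} (hz : z ∈ F.box x) : ∃ δ : Path x z, Set.range δ ⊆ F.box x :=
  (F.exists_homotopicallySmall_nhds x).choose_spec.2.2 x (mem_of_mem_nhds (F.box_mem_nhds x)) z hz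

/-- A path in `M` along which a transverse coordinate is constant is a path in a leaf. -/
def finePath {φ : ProductChart n M} (hφ : F.IsFoliatedChart φ) {p q : M} (δ : Path p q)
    (hδ : ∀ t, δ t ∈ φ.source) (hδ' : ∀ t, (φ (δ t)).2 = (φ p).2) :
    Path (F.toFine p) (F.toFine q) where
  toFun t := F.toFine (δ t)
  continuous_toFun := continuous_iff_continuousAt.2 fun t =>
    tendsto_toFine (hφ.isTransverse (hδ t)) δ.continuous.continuousAt
      (Filter.Eventually.of_forall fun s => (hδ' s).trans (hδ' t).symm)
  source' := by simp
  target' := by simp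

variable (F) in
/-- The homotopy class `δ` of paths in a leaf is parallel to the class `γ` of paths in a possibly
different leaf: in `M` they differ by short paths between their end points. The condition is empty
if the end points of `δ` are not in the chosen boxes around those of `γ`. -/
def IsParallel {x y p q : F.FineSpace} (γ : Path.Homotopic.Quotient x y)
    (δ : Path.Homotopic.Quotient p q) : Prop :=
  ∀ (a : Path (F.fineToM x) (F.fineToM p)) (b : Path (F.fineToM y) (F.fineToM q)),
    Set.range a ⊆ F.box (F.fineToM x) → Set.range b ⊆ F.box (F.fineToM y) →
      (γ.map F.fineToM).trans (.mk b) = Path.Homotopic.Quotient.trans (.mk a) (δ.map F.fineToM)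

theorem IsParallel.trans {x y z p q r : F.FineSpace} {γ : Path.Homotopic.Quotient x y}
    {γ' : Path.Homotopic.Quotient y z} {δ : Path.Homotopic.Quotient p q}
    {δ' : Path.Homotopic.Quotient q r} (h : F.IsParallel γ δ) (h' : F.IsParallel γ' δ')
    (hq : F.fineToM q ∈ F.box (F.fineToM y)) : F.IsParallel (γ.trans γ') (δ.trans δ') := by
  intro a c ha hc
  obtain ⟨b, hb⟩ := exists_path_box hq
  rw [Path.Homotopic.Quotient.trans_map, Path.Homotopic.Quotient.trans_assoc, h' b c hb hc,
    ← Path.Homotopic.Quotient.trans_assoc, h a b ha hb, Path.Homotopic.Quotient.trans_map,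
    Path.Homotopic.Quotient.trans_assoc]

/-- Paths in a leaf can be pushed to the nearby leaves: the end points of the new path may be any
two points close to the end points of the given one at which a transverse function and its
continuation take the same value. -/
theorem Continues.eventually_exists_parallel {x y : F.FineSpace}
    (γ : Path.Homotopic.Quotient x y) : ∀ {f g : M → ℝ}, Continues γ f g →
      ∀ᶠ q : M × M in 𝓝 (F.toFine.symm x) ×ˢ 𝓝 (F.toFine.symm y), f q.1 = g q.2 →
        ∃ δ : Path.Homotopic.Quotient (F.toFine q.1) (F.toFine q.2),
          Continues δ f g ∧ F.IsParallel γ δ := by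
  refine Path.Homotopic.Quotient.induction_local (X := F.FineSpace) (P := fun {x y} γ =>
    ∀ {f g : M → ℝ}, Continues γ f g →
      ∀ᶠ q : M × M in 𝓝 (F.toFine.symm x) ×ˢ 𝓝 (F.toFine.symm y), f q.1 = g q.2 →
        ∃ δ : Path.Homotopic.Quotient (F.toFine q.1) (F.toFine q.2),
          Continues δ f g ∧ F.IsParallel γ δ) ?_ ?_ γ
  · intro x y z γ γ' ih ih' f g h
    obtain ⟨l, hl, hl'⟩ := h.exists_of_trans
    obtain ⟨Px, hPx, Py, hPy, H⟩ := Filter.eventually_prod_iff.1 (ih hl)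
    obtain ⟨Py', hPy', Pz, hPz, H'⟩ := Filter.eventually_prod_iff.1 (ih' hl')
    -- intermediate points near `y` with prescribed value of the continuation `l` of `f`
    have himage : l '' {q | Py q ∧ Py' q ∧ q ∈ F.box (F.toFine.symm y)} ∈
        𝓝 (f (F.toFine.symm x)) := by
      rw [← hl.apply_eq, ← hl.right.map_nhds]
      exact Filter.image_mem_map (hPy.and (hPy'.and (F.box_mem_nhds _)))
    refine Filter.eventually_prod_iff.2 ⟨_, hPx.and (h.left.continuousAt.eventually himage), _, hPz,
      ?_⟩
    rintro p ⟨hp, q, ⟨hq, hq', hqb⟩, hqp⟩ r hr hpr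
    obtain ⟨δ, hδ, hδp⟩ := H hp hq hqp.symm
    obtain ⟨δ', hδ', hδp'⟩ := H' hq' hr (hqp.trans hpr)
    exact ⟨δ.trans δ', hδ.trans hδ', hδp.trans hδp' hqb⟩
  · intro x
    obtain ⟨φ, hφ, hx⟩ := F.covers (F.toFine.symm x)
    have hφ' := isFoliatedChart_of_mem_atlas hφ
    obtain ⟨V, hV, hVφ⟩ := hφ'.exists_nhds_coord_eq hx
    obtain ⟨B, hB, -, hBφ, hBs, hBp⟩ := exists_box φ hx Filter.univ_mem
    obtain ⟨B', hB'B, hB'o, hxB'⟩ := mem_nhds_iff.1 hB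
    refine ⟨V ∩ F.toFine.symm ⁻¹' B', Filter.inter_mem hV
      ((hB'o.preimage F.continuous_toFine_symm).mem_nhds hxB'), fun {p q} γ hγ f g h => ?_⟩
    have hp : p ∈ V ∩ F.toFine.symm ⁻¹' B' := by simpa only [γ.source] using hγ 0
    have hq : q ∈ V ∩ F.toFine.symm ⁻¹' B' := by simpa only [γ.target] using hγ 1
    have hγ' : ∀ t, F.toFine.symm (γ t) ∈ φ.source ∧
        (φ (F.toFine.symm (γ t))).2 = (φ (F.toFine.symm p)).2 := fun t =>
      ⟨(hVφ _ (hγ t).1).1, (hVφ _ (hγ t).1).2.trans (hVφ _ hp.1).2.symm⟩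
    obtain ⟨l, hl, e⟩ := h.left.exists_eq_chart hφ' (hVφ _ hp.1).1
    have e' : ∀ᶠ z in 𝓝 (F.toFine.symm q), g z = l (φ z).2 := Filter.EventuallyEq.symm
      (((Continues.of_chart hφ' hγ' l hl).congr e (Filter.EventuallyEq.refl _ _)).eventuallyEq h)
    have hlq : (φ (F.toFine.symm q)).2 ∈ l.source := by
      rw [(hVφ _ hq.1).2, ← (hVφ _ hp.1).2]
      exact hl
    -- neighbourhoods of the end points that are contained in both relevant boxes
    have small : ∀ w : M, w ∈ B' → ∃ A ∈ 𝓝 w, ∀ z ∈ A, z ∈ B ∧ ∃ a : Path w z,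
        Set.range a ⊆ B ∧ Set.range a ⊆ F.box w := by
      intro w hw
      obtain ⟨A, hA, hAB, -, -, hAp⟩ := exists_box φ (hBφ (hB'B hw))
        (Filter.inter_mem (Filter.mem_of_superset (hB'o.mem_nhds hw) hB'B) (F.box_mem_nhds w))
      refine ⟨A, hA, fun z hz => ⟨(hAB hz).1, ?_⟩⟩
      obtain ⟨a, ha, -⟩ := hAp w (mem_of_mem_nhds hA) z hz
      exact ⟨a, fun _ h => (hAB (ha h)).1, fun _ h => (hAB (ha h)).2⟩
    obtain ⟨A, hA, hAa⟩ := small (F.toFine.symm p) hp.2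
    obtain ⟨A', hA', hAa'⟩ := small (F.toFine.symm q) hq.2
    -- for `z`, `w` close to `p`, `q`, the new path is a segment from `z` to `w` in the chart `φ`
    refine Filter.eventually_prod_iff.2 ⟨_, ((Filter.Eventually.and hA e.eventually_nhds).and
      ((continuousAt_transverseCoord φ (hVφ _ hp.1).1).eventually (l.open_source.mem_nhds hl))),
      _, ((Filter.Eventually.and hA' e'.eventually_nhds).and
      ((continuousAt_transverseCoord φ (hVφ _ hq.1).1).eventually (l.open_source.mem_nhds hlq))),
      ?_⟩
    rintro z ⟨⟨hzA, hze⟩, hzl⟩ w ⟨⟨hwA, hwe⟩, hwl⟩ hzw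
    obtain ⟨hzB, a₀, ha₀, ha₀'⟩ := hAa z hzA
    obtain ⟨hwB, b₀, hb₀, hb₀'⟩ := hAa' w hwA
    have hzw' : (φ z).2 = (φ w).2 := by
      refine l.injOn hzl hwl ?_
      have h₁ : f z = l (φ z).2 := hze.self_of_nhds
      have h₂ : g w = l (φ w).2 := hwe.self_of_nhds
      exact h₁.symm.trans (hzw.trans h₂)
    obtain ⟨δ, hδB, hδ⟩ := hBp z hzB w hwB
    have hδφ : ∀ t, δ t ∈ φ.source := fun t => hBφ (hδB ⟨t, rfl⟩)
    refine ⟨.mk (finePath hφ' δ hδφ (hδ hzw')), ?_, ?_⟩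
    · exact (Continues.of_chart hφ' (γ := finePath hφ' δ hδφ (hδ hzw'))
        (fun t => ⟨hδφ t, hδ hzw' t⟩) l hzl).congr hze hwe
    · intro a b ha hb
      have ea : Path.Homotopic.Quotient.mk a = .mk a₀ := isHomotopicallySmall_box _ _ _ ha ha₀'
      have eb : Path.Homotopic.Quotient.mk b = .mk b₀ := isHomotopicallySmall_box _ _ _ hb hb₀'
      rw [ea, eb]
      refine hBs ((γ.map F.fineToM.continuous).trans b₀) (a₀.trans δ) ?_ ?_
      · refine (Path.trans_range _ _).subset.trans (Set.union_subset ?_ hb₀)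
        rintro _ ⟨t, rfl⟩
        exact hB'B (hγ t).2
      · exact (Path.trans_range _ _).subset.trans (Set.union_subset ha₀ hδB)

/-! ### Transverse orientations -/

variable (F) in
/-- Near `x`, the function `f` is the transverse coordinate of a chart of the atlas followed by an
increasing local homeomorphism. For an oriented atlas this says that `f` respects the transverse
orientation. -/
def IsPositiveAt (x : M) (f : M → ℝ) : Prop :=
  ∃ φ ∈ F.atlas, x ∈ φ.source ∧ ∃ h : OpenPartialHomeomorph ℝ ℝ, (φ x).2 ∈ h.source ∧
    StrictMonoOn h h.source ∧ ∀ᶠ y in 𝓝 x, f y = h (φ y).2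

theorem isPositiveAt_chart {φ : ProductChart n M} (hφ : φ ∈ F.atlas) {x : M} (hx : x ∈ φ.source) :
    F.IsPositiveAt x fun y => (φ y).2 :=
  ⟨φ, hφ, hx, OpenPartialHomeomorph.refl ℝ, by simp, fun _ _ _ _ h => h, by simp⟩

theorem IsPositiveAt.exists_eq_chart (hF : F.IsOrientedAtlas) {x : M} {f : M → ℝ}
    (hf : F.IsPositiveAt x f) {ψ : ProductChart n M} (hψ : ψ ∈ F.atlas) (hx : x ∈ ψ.source) :
    ∃ h : OpenPartialHomeomorph ℝ ℝ, (ψ x).2 ∈ h.source ∧ StrictMonoOn h h.source ∧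
      ∀ᶠ y in 𝓝 x, f y = h (ψ y).2 := by
  obtain ⟨φ, hφ, hxφ, k, hk, hmono, e⟩ := hf
  obtain ⟨g, ⟨-, -, hg⟩, hgmono⟩ := hF ψ hψ φ hφ x ⟨hx, hxφ⟩
  refine ⟨g.trans k, ?_, ?_, ?_⟩
  · rw [OpenPartialHomeomorph.trans_source]
    have := hg.self_of_nhds
    exact ⟨this.1, by simpa [← this.2] using hk⟩
  · rw [OpenPartialHomeomorph.trans_source]
    intro u hu v hv huv
    exact hmono hu.2 hv.2 (hgmono hu.1 hv.1 huv)
  · filter_upwards [e, hg] with y hy hy'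
    simp [hy, hy'.2]

/-- Two positive functions differ by an increasing change of the transverse coordinate. -/
theorem IsPositiveAt.exists_strictMonoOn (hF : F.IsOrientedAtlas) {x : M} {f : M → ℝ} {k : ℝ → ℝ}
    (hf : F.IsPositiveAt x f) (hkf : F.IsPositiveAt x fun y => k (f y)) :
    ∃ J ∈ 𝓝 (f x), StrictMonoOn k J := by
  obtain ⟨φ, hφ, hx, h, hh, hmono, e⟩ := hf
  obtain ⟨l, hl, hlmono, e'⟩ := hkf.exists_eq_chart hF hφ hx
  have hkh : ∀ᶠ u in 𝓝 (φ x).2, k (h u) = l u := by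
    rw [← map_nhds_transverseCoord φ hx, Filter.eventually_map]
    filter_upwards [e, e'] with y hy hy'
    rw [← hy, hy']
  refine ⟨h '' {u | u ∈ h.source ∧ u ∈ l.source ∧ k (h u) = l u}, ?_, ?_⟩
  · rw [e.self_of_nhds]
    exact h.image_mem_nhds hh (Filter.Eventually.and (h.open_source.mem_nhds hh)
      (Filter.Eventually.and (l.open_source.mem_nhds hl) hkh))
  · rintro _ ⟨u, ⟨hu, hul, huk⟩, rfl⟩ _ ⟨v, ⟨hv, hvl, hvk⟩, rfl⟩ huv
    rw [huk, hvk]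
    exact hlmono hul hvl ((hmono.lt_iff_lt hu hv).1 huv)

/-- Continuation preserves the orientation given by an oriented atlas of foliated charts. -/
theorem IsPositiveAt.continues {G : CodimOneFoliation n M}
    (hGF : ∀ φ ∈ G.atlas, F.IsFoliatedChart φ) (hG : G.IsOrientedAtlas) {x y : F.FineSpace}
    (γ : Path.Homotopic.Quotient x y) : ∀ {f g : M → ℝ}, Continues γ f g →
      G.IsPositiveAt (F.toFine.symm x) f → G.IsPositiveAt (F.toFine.symm y) g := by
  refine Path.Homotopic.Quotient.induction_local (X := F.FineSpace) (P := fun {x y} γ =>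
    ∀ {f g : M → ℝ}, Continues γ f g →
      G.IsPositiveAt (F.toFine.symm x) f → G.IsPositiveAt (F.toFine.symm y) g) ?_ ?_ γ
  · intro x y z γ δ hγ hδ f g h hf
    obtain ⟨l, hl, hl'⟩ := h.exists_of_trans
    exact hδ hl' (hγ hl hf)
  · intro x
    obtain ⟨ψ, hψ, hx⟩ := G.covers (F.toFine.symm x)
    obtain ⟨U, hU, hUψ⟩ := (hGF ψ hψ).exists_nhds_coord_eq hx
    refine ⟨U, hU, fun {p q} γ hγ f g h hf => ?_⟩
    have hp : p ∈ U := by simpa using hγ 0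
    have hq : q ∈ U := by simpa using hγ 1
    obtain ⟨l, hl, hlmono, e⟩ := hf.exists_eq_chart hG hψ (hUψ _ hp).1
    have hc := Continues.of_chart (hGF ψ hψ) (γ := γ) (fun t =>
      ⟨(hUψ _ (hγ t)).1, (hUψ _ (hγ t)).2.trans (hUψ _ hp).2.symm⟩) l hl
    have e' := (hc.congr e (Filter.EventuallyEq.refl _ _)).eventuallyEq h
    refine ⟨ψ, hψ, (hUψ _ hq).1, l, ?_, hlmono, e'.symm⟩
    rw [(hUψ _ hq).2, ← (hUψ _ hp).2]
    exact hl

/-! ### Loops with trivial holonomy -/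

/-- A loop that fixes one transverse germ fixes all of them. -/
theorem Continues.loop {x : F.FineSpace} {γ : Path.Homotopic.Quotient x x} {f g : M → ℝ}
    (h : Continues γ f f) (hg : F.IsTransverse (F.toFine.symm x) g) : Continues γ g g := by
  obtain ⟨k, hk, e⟩ := h.left.exists_eq_comp hg
  exact (h.comp hk).congr e e

/-- The classes of loops at `x` that fix the germ of `f` at `x`. -/
def germStabilizer (x : F.FineSpace) (f : M → ℝ) (hf : F.IsTransverse (F.toFine.symm x) f) :
    Subgroup (FundamentalGroup F.FineSpace x) where
  carrier := {γ | Continues (FundamentalGroup.toPath γ) f f}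
  one_mem' := Continues.refl hf
  mul_mem' h h' := Continues.trans h' h
  inv_mem' h := Continues.symm h

theorem Continues.iterate {x : F.FineSpace} {γ : FundamentalGroup F.FineSpace x} {f : M → ℝ}
    {k : OpenPartialHomeomorph ℝ ℝ} (hk : f (F.toFine.symm x) ∈ k.source)
    (h : Continues γ.toPath f fun y => k (f y)) (m : ℕ) :
    Continues (FundamentalGroup.toPath (γ ^ m)) f fun y => k^[m] (f y) := by
  induction m with
  | zero =>
    rw [pow_zero]
    exact Continues.refl h.left
  | succ m ih =>
    have h' := h.trans (ih.comp hk)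
    rw [pow_succ]
    simp only [Function.iterate_succ_apply']
    exact h'

/-- For a transversely oriented foliation, a loop has trivial holonomy if one of its powers has:
holonomy germs are increasing. It suffices to look at the transverse coordinate of an oriented
chart. -/
theorem Continues.of_pow {G : CodimOneFoliation n M}
    (hGF : ∀ φ ∈ G.atlas, F.IsFoliatedChart φ) (hG : G.IsOrientedAtlas) {x : F.FineSpace}
    {γ : FundamentalGroup F.FineSpace x} {f : M → ℝ} {m : ℕ} (hm : 1 ≤ m)
    (h : Continues (FundamentalGroup.toPath (γ ^ m)) f f) : Continues γ.toPath f f := by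
  obtain ⟨ψ, hψ, hx⟩ := G.covers (F.toFine.symm x)
  have hψt := (hGF ψ hψ).isTransverse hx
  have hψp := isPositiveAt_chart hψ hx
  obtain ⟨g, hg⟩ := hψt.exists_continues γ.toPath
  obtain ⟨k, hk, e⟩ := hψt.exists_eq_comp hg.right
  have hc : Continues γ.toPath (fun y => (ψ y).2) fun y => k (ψ y).2 :=
    hg.congr (Filter.EventuallyEq.refl _ _) (Filter.EventuallyEq.symm e)
  obtain ⟨J, hJ, hkJ⟩ := hψp.exists_strictMonoOn hG (IsPositiveAt.continues hGF hG _ hc hψp)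
  have hpow := (hc.iterate (f := fun y => (ψ y).2) hk m).eventuallyEq (h.loop hψt)
  have hiter : (k : ℝ → ℝ)^[m] =ᶠ[𝓝 (ψ (F.toFine.symm x)).2] id :=
    hψt.eventually_eq_of_comp hpow
  have hkid := eventually_eq_of_iterate_eq hJ hkJ (k.continuousAt hk) hc.apply_eq hm hiter
  have hψc : Continues γ.toPath (fun y => (ψ y).2) fun y => (ψ y).2 :=
    hc.congr (Filter.EventuallyEq.refl _ _)
      ((hψt.continuousAt.eventually hkid).mono fun y hy => Eq.symm hy)
  exact hψc.loop h.left

/-- A loop that fixes a transverse germ has trivial holonomy. -/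
theorem Continues.hasTrivialHolonomy {x : M} {γ : Path (F.toFine x) (F.toFine x)} {f : M → ℝ}
    (h : Continues (.mk γ) f f) : F.HasTrivialHolonomy γ := by
  intro φ hφ l hl
  obtain ⟨hx, -, hc⟩ := hl.continues
  have hφt := (isFoliatedChart_of_mem_atlas hφ).isTransverse hx
  exact hφt.eventually_eq_of_comp (l := id) (hc.symm.eventuallyEq (h.loop hφt).symm)

/-- Here the existence of a holonomy map along the loop matters. -/
theorem HasTrivialHolonomy.continues {x : M} {γ : Path (F.toFine x) (F.toFine x)}
    (h : F.HasTrivialHolonomy γ) {f : M → ℝ} (hf : F.IsTransverse x f) :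
    Continues (.mk γ) f f := by
  obtain ⟨φ, hφ, hx⟩ := F.covers x
  have hφt := (isFoliatedChart_of_mem_atlas hφ).isTransverse hx
  obtain ⟨l, hl⟩ := exists_isHolonomyMap γ hφ hx hφ hx
  have e := hφt.continuousAt.eventually (h φ hφ l hl)
  have hc := hl.continues.2.2.congr (f' := fun y => (φ y).2) (g' := fun y => (φ y).2)
    (Filter.EventuallyEq.symm e) (Filter.EventuallyEq.refl _ _)
  exact hc.loop hf

/-! ### The fundamental groups of the leaves -/

variable (F) in
/-- The homomorphism from the fundamental group of a leaf to that of `M` with the leaf topology. -/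
noncomputable def leafHom (x : M) : FundamentalGroup (F.LeafSpace x) (F.leafBase x) →*
    FundamentalGroup F.FineSpace (F.toFine x) :=
  FundamentalGroup.map ⟨Subtype.val, continuous_subtype_val⟩ (F.leafBase x)

/-- A loop for the leaf topology stays in the leaf of its base point. -/
theorem leafHom_surjective (x : M) : Function.Surjective (F.leafHom x) := by
  intro γ
  induction γ using Path.Homotopic.Quotient.ind with | mk γ
  let γ' : Path (F.leafBase x) (F.leafBase x) :=
    { toFun := fun t => ⟨γ t, ⟨(γ.subpath 0 t).cast γ.source.symm rfl⟩⟩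
      continuous_toFun := γ.continuous.subtype_mk _
      source' := Subtype.ext γ.source
      target' := Subtype.ext γ.target }
  exact ⟨Path.Homotopic.Quotient.mk γ', rfl⟩

variable (F) in
/-- The homomorphism of fundamental groups from `M` with the leaf topology to `M`. -/
noncomputable def fineHom (x : M) :
    FundamentalGroup F.FineSpace (F.toFine x) →* FundamentalGroup M x :=
  FundamentalGroup.map F.fineToM (F.toFine x)

theorem fineHom_leafHom (x : M) (γ : FundamentalGroup (F.LeafSpace x) (F.leafBase x)) :
    F.fineHom x (F.leafHom x γ) = FundamentalGroup.map (F.leafInclusion x) (F.leafBase x) γ := by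
  induction γ using Path.Homotopic.Quotient.ind with | mk γ
  rfl

/-- The classes in `π₁ M` of parallel loops correspond under the change of base point along a short
path. -/
theorem IsParallel.fineHom_eq {x z : M} {γ : FundamentalGroup F.FineSpace (F.toFine x)}
    {δ : FundamentalGroup F.FineSpace (F.toFine z)} (h : F.IsParallel γ.toPath δ.toPath)
    {a : Path x z} (ha : Set.range a ⊆ F.box x) :
    F.fineHom z δ = FundamentalGroup.fundamentalGroupMulEquivOfPath a (F.fineHom x γ) := by
  let a' : Path (F.fineToM (F.toFine x)) (F.fineToM (F.toFine z)) := a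
  have h' := congrArg (Path.Homotopic.Quotient.symm (.mk a')).trans (h a' a' ha ha)
  rw [← Path.Homotopic.Quotient.trans_assoc, ← Path.Homotopic.Quotient.trans_assoc,
    Path.Homotopic.Quotient.symm_trans, Path.Homotopic.Quotient.refl_trans,
    Path.Homotopic.Quotient.trans_assoc] at h'
  exact h'.symm

end CodimOneFoliation

theorem lemma3 {n : ℕ} {M : Type*} [TopologicalSpace M] [T2Space M] [SecondCountableTopology M]
    (F : CodimOneFoliation n M) (horient : F.IsTransverselyOrientable) (hmin : F.IsMinimal)
    (k : ℕ)
    (hgrowth : ∀ x : M,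
      HasPolynomialGrowthOfDegree (FundamentalGroup (F.LeafSpace x) (F.leafBase x)) k)
    (hleaf : ∃ x₀ : M, F.LeafWithoutHolonomy x₀ ∧
      Function.Injective (FundamentalGroup.map (F.leafInclusion x₀) (F.leafBase x₀))) :
    F.IsWithoutHolonomy := by
  obtain ⟨G, hGF, hG⟩ := horient
  obtain ⟨x₀, hx₀, hinj⟩ := hleaf
  obtain ⟨φ, hφ, hxφ⟩ := F.covers x₀
  set f : M → ℝ := fun y => (φ y).2
  have hf : F.IsTransverse x₀ f :=
    (CodimOneFoliation.isFoliatedChart_of_mem_atlas hφ).isTransverse hxφ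
  have hx₀' : ∀ γ : FundamentalGroup F.FineSpace (F.toFine x₀),
      CodimOneFoliation.Continues γ.toPath f f := by
    intro γ
    induction γ using Path.Homotopic.Quotient.ind with | mk γ
    exact (hx₀ x₀ (mem_pathComponent_self (F.toFine x₀)) γ).continues hf
  obtain ⟨S, hSfin, hSgen, -⟩ := hgrowth x₀
  -- all leaves that pass close to `x₀` contain loops parallel to the generators
  have hnear : ∀ᶠ z in 𝓝 x₀, ∀ s ∈ S, ∃ δ : FundamentalGroup F.FineSpace (F.toFine z),
      CodimOneFoliation.Continues δ.toPath f f ∧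
        F.IsParallel (F.leafHom x₀ s).toPath δ.toPath := by
    refine (Filter.eventually_all_finite hSfin).2 fun s _ => ?_
    have h := CodimOneFoliation.Continues.eventually_exists_parallel _ (hx₀' (F.leafHom x₀ s))
    exact h.diag_of_prod.mono fun z hz => hz rfl
  intro x y _ γ
  obtain ⟨z, ⟨c⟩, hz, hzf, hzb⟩ := (hmin y).inter_nhds_nonempty
    (hnear.and (hf.eventually.and (F.box_mem_nhds x₀)))
  obtain ⟨a, ha⟩ := CodimOneFoliation.exists_path_box hzb
  -- the subgroup of loops with trivial holonomy; it contains the parallels of the generators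
  let N : Subgroup (FundamentalGroup (F.LeafSpace z) (F.leafBase z)) :=
    (CodimOneFoliation.germStabilizer (F.toFine z) f hzf).comap (F.leafHom z)
  let ι : FundamentalGroup (F.LeafSpace x₀) (F.leafBase x₀) →* FundamentalGroup M z :=
    (FundamentalGroup.fundamentalGroupMulEquivOfPath a).toMonoidHom.comp
      ((F.fineHom x₀).comp (F.leafHom x₀))
  have hι : Function.Injective ι := by
    refine (FundamentalGroup.fundamentalGroupMulEquivOfPath a).injective.comp fun s t hst => hinj ?_
    rw [← CodimOneFoliation.fineHom_leafHom, ← CodimOneFoliation.fineHom_leafHom]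
    exact hst
  have hN : ∀ s, ∃ t ∈ N, ((F.fineHom z).comp (F.leafHom z)) t = ι s := by
    have hle : Subgroup.closure S ≤ (N.map ((F.fineHom z).comp (F.leafHom z))).comap ι := by
      refine (Subgroup.closure_le _).2 fun s hs => ?_
      obtain ⟨δ, hδ, hsδ⟩ := hz s hs
      obtain ⟨t, rfl⟩ := CodimOneFoliation.leafHom_surjective z δ
      exact ⟨t, hδ, hsδ.fineHom_eq ha⟩
    intro s
    rw [hSgen] at hle
    exact hle (Subgroup.mem_top s)
  -- `g` is the loop `γ`, moved to the base point `z`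
  obtain ⟨g, hg⟩ := CodimOneFoliation.leafHom_surjective z
    (((Path.Homotopic.Quotient.symm (.mk c)).trans (.mk γ)).trans (.mk c))
  obtain ⟨m, hm, hgm⟩ := (hgrowth z).exists_pow_mem (hgrowth x₀) hι _ N hN g
  have hgm' : CodimOneFoliation.Continues (FundamentalGroup.toPath (F.leafHom z g ^ m)) f f := by
    rw [← map_pow]
    exact hgm
  have hc := CodimOneFoliation.Continues.of_pow hGF hG hm hgm'
  rw [hg] at hc
  -- conjugate back from `z` to `y`
  obtain ⟨l', hl', hf'⟩ := CodimOneFoliation.Continues.exists_of_trans hc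
  obtain ⟨l, hl, hl'⟩ := hl'.exists_of_trans
  exact (hl'.congr (Filter.EventuallyEq.refl _ l)
    (hl.eventuallyEq hf'.symm)).hasTrivialHolonomy
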